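/- Conventions. A convenient vector space is a Hausdorff locally convex real vector space $E$ in which every Mackey-Cauchy sequence converges. A curve $\mathbb R\to E$ is smooth if all its iterated derivatives exist; a mapping between locally convex spaces is smooth if it maps smooth curves to smooth curves. $E^*$ denotes the space of all bounded linear functionals on $E$ with the topology of uniform convergence on bounded sets, $\langle v,l\rangle=l(v)$ for $v\in E$, $l\in E^*$, and $i_E:E\to E^{**}$, $i_E(v)(l)=l(v)$, is the canonical injection. For a smooth function $f$ put $df_x(y)=\frac{d}{dt}\big|_{t=0}f(x+ty)$, and let $d^kf_x(y_1,\dots,y_k)$ be the iterated derivative, defined recursively by $d^{k+1}f_x(y_1,\dots,y_{k+1})=d\big(z\mapsto d^kf_z(y_2,\dots,y_{k+1})\big)_x(y_1)$. Lemma. Let $\mathfrak g$ be a convenient Lie algebra, i.e., a convenient vector space with a Lie bracket $[\;,\;]:\mathfrak g\times\mathfrak g\to\mathfrak g$ that is a bounded bilinear mapping, and let $P:\mathfrak g^*\to L^2_{\mathrm{skew}}(\mathfrak g;\mathbb R)$, $P_x(X,Y)=\langle [X,Y],x\rangle$, be the dual mapping of the bracket, with values in the bounded skew-symmetric bilinear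 forms on $\mathfrak g$. For a smooth function $f:\mathfrak g^*\to\mathbb R$ consider the following conditions: (1) There is a smooth mapping $g:\mathfrak g^*\to\mathfrak g$ with $df_x=i_{\mathfrak g}(g(x))$ for all $x\in\mathfrak g^*$. (2) For every $k\ge 1$ and all $x,y_2,\dots,y_k\in\mathfrak g^*$ the function $d^kf_x(\;\cdot\;,y_2,\dots,y_k)$ belongs to $i_{\mathfrak g}(\mathfrak g)\subset\mathfrak g^{**}$, and the resulting mapping $(\mathfrak g^*)^k\to\mathfrak g$, $(x,y_2,\dots,y_k)\mapsto d^kf_x(\;\cdot\;,y_2,\dots,y_k)$, is smooth. (3) $f$ has a smooth $P$-gradient $\operatorname{grad}^Pf=P\circ df$: there is a smooth mapping $\operatorname{grad}^Pf:\mathfrak g^*\to\mathfrak g^*$ such that for every $x\in\mathfrak g^*$ the differential $df_x$ lies in $i_{\mathfrak g}(\mathfrak g)$ and, regarding $df_x$ as an element of $\mathfrak g$, $P_x(df_x,y)=\langle y,\operatorname{grad}^Pf(x)\rangle$ for all $y\in\mathfrak g$. Then (1) and (2) are equivalent, and each of them implies (3). Moreover, if (2) holds, then the property in (2) holds for every entry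 of $d^kf_x$ in place of the first one, for all $k\ge1$. -/

import Mathlib

open Filter Topology Set

noncomputable section

namespace Convenient

/-! ### Convenient vector spaces -/

section Spaces

/-- A sequence `x` is Mackey-Cauchy: `x m - x n ∈ μ (m, n) • B` for a bounded absolutely convex
set `B` and real numbers `μ (m, n)` that tend to `0` as `m, n → ∞`. -/
def IsMackeyCauchy {E : Type*} [AddCommGroup E] [Module ℝ E] [TopologicalSpace E]
    (x : ℕ → E) : Prop :=
  ∃ B : Set E, Bornology.IsVonNBounded ℝ B ∧ AbsConvex ℝ B ∧
    ∃ μ : ℕ × ℕ → ℝ, Tendsto μ atTop (𝓝 0) ∧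
      ∀ m n, ∃ b ∈ B, x m - x n = μ (m, n) • b

/-- A convenient vector space: a Hausdorff locally convex space over `ℝ` in which every
Mackey-Cauchy sequence converges. -/
class ConvenientSpace (E : Type*) [AddCommGroup E] [Module ℝ E] [TopologicalSpace E] : Prop
    extends IsTopologicalAddGroup E, ContinuousSMul ℝ E, LocallyConvexSpace ℝ E, T2Space E where
  mackey_complete : ∀ x : ℕ → E, IsMackeyCauchy x → ∃ a, Tendsto x atTop (𝓝 a)

/-- A convenient Lie algebra: a Lie algebra over `ℝ` on a convenient vector space whose bracket is
a bounded bilinear map. -/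
class ConvenientLieAlgebra (𝔤 : Type*) [LieRing 𝔤] [LieAlgebra ℝ 𝔤] [TopologicalSpace 𝔤] : Prop
    extends ConvenientSpace 𝔤 where
  bounded_bracket : ∀ A B : Set 𝔤, Bornology.IsVonNBounded ℝ A → Bornology.IsVonNBounded ℝ B →
    Bornology.IsVonNBounded ℝ (Set.image2 (fun X Y => ⁅X, Y⁆) A B)

end Spaces

/-! ### Smooth curves and smooth mappings -/

section Smooth

/-- A curve is smooth if all its iterated derivatives `D 0 = c`, `D 1 = c'`, `D 2 = c''`, … exist
as limits of difference quotients. -/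
def IsSmoothCurve {E : Type*} [AddCommGroup E] [Module ℝ E] [TopologicalSpace E]
    (c : ℝ → E) : Prop :=
  ∃ D : ℕ → ℝ → E, D 0 = c ∧
    ∀ n t, Tendsto (fun h : ℝ => h⁻¹ • (D n (t + h) - D n t)) (𝓝[≠] 0) (𝓝 (D (n + 1) t))

/-- A mapping is smooth if it maps smooth curves to smooth curves. -/
def IsSmoothMap {E F : Type*} [AddCommGroup E] [Module ℝ E] [TopologicalSpace E]
    [AddCommGroup F] [Module ℝ F] [TopologicalSpace F] (f : E → F) : Prop :=
  ∀ c : ℝ → E, IsSmoothCurve c → IsSmoothCurve (fun t => f (c t))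

/-- The differential `df_x(v)`, the derivative at `0` of `t ↦ f (x + t v)`; the latter function is
smooth whenever `f` is. -/
def differential {E : Type*} [AddCommGroup E] [Module ℝ E] (f : E → ℝ) (x v : E) : ℝ :=
  deriv (fun t : ℝ => f (x + t • v)) 0

/-- The iterated derivative `d^k f_x(y₁, …, y_k)`, given recursively by
`d^{k+1} f_x(y₁, y₂, …, y_{k+1}) = d(z ↦ d^k f_z(y₂, …, y_{k+1}))_x(y₁)`. -/
def iteratedDifferential {E : Type*} [AddCommGroup E] [Module ℝ E] (f : E → ℝ) :
    (k : ℕ) → E → (Fin k → E) → ℝ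
  | 0, x, _ => f x
  | k + 1, x, y => differential (fun z => iteratedDifferential f k z (Fin.tail y)) x (y 0)

end Smooth

/-! ### The dual of bounded linear functionals -/

section Dual

variable (E : Type*) [AddCommGroup E] [Module ℝ E] [TopologicalSpace E]

/-- The bounded linear functionals on `E`. -/
def boundedFunctionals : Submodule ℝ (E →ₗ[ℝ] ℝ) where
  carrier := {l | ∀ B : Set E, Bornology.IsVonNBounded ℝ B → Bornology.IsVonNBounded ℝ (l '' B)}
  zero_mem' := fun B _ =>
    (Bornology.isVonNBounded_singleton (0 : ℝ)).subset (by rintro _ ⟨x, -, rfl⟩; simp)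
  add_mem' := fun {a b} ha hb B hB =>
    ((ha B hB).add (hb B hB)).subset (by
      rintro _ ⟨x, hx, rfl⟩
      exact Set.add_mem_add (Set.mem_image_of_mem a hx) (Set.mem_image_of_mem b hx))
  smul_mem' := fun r a ha B hB => by
    have h := (ha B hB).image (r • ContinuousLinearMap.id ℝ ℝ)
    refine h.subset ?_
    rintro _ ⟨x, hx, rfl⟩
    exact ⟨a x, Set.mem_image_of_mem a hx, by simp⟩

/-- The dual `E*` of a convenient vector space: all bounded linear functionals, with the topology
of uniform convergence on bounded sets. -/
def BoundedDual : Type _ := boundedFunctionals E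

namespace BoundedDual

variable {E}

instance : AddCommGroup (BoundedDual E) := inferInstanceAs (AddCommGroup (boundedFunctionals E))

instance : Module ℝ (BoundedDual E) := inferInstanceAs (Module ℝ (boundedFunctionals E))

/-- The underlying linear functional. -/
def toLin : BoundedDual E →ₗ[ℝ] (E →ₗ[ℝ] ℝ) := (boundedFunctionals E).subtype

instance : CoeFun (BoundedDual E) (fun _ => E → ℝ) := ⟨fun l => toLin l⟩

/-- Evaluation of functionals, as a linear map into the space of all functions. -/
def toFunLin : BoundedDual E →ₗ[ℝ] (E → ℝ) where
  toFun l := l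
  map_add' _ _ := rfl
  map_smul' _ _ := rfl

instance : TopologicalSpace (BoundedDual E) :=
  TopologicalSpace.induced
    (UniformOnFun.ofFun {B : Set E | Bornology.IsVonNBounded ℝ B} ∘ toFunLin)
    (UniformOnFun.topologicalSpace E ℝ {B : Set E | Bornology.IsVonNBounded ℝ B})

theorem bounded (l : BoundedDual E) {B : Set E} (hB : Bornology.IsVonNBounded ℝ B) :
    Bornology.IsVonNBounded ℝ (l '' B) := l.2 B hB

theorem ext {l m : BoundedDual E} (h : ∀ x, l x = m x) : l = m :=
  Subtype.ext (LinearMap.ext h)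

instance : ContinuousSMul ℝ (BoundedDual E) :=
  UniformOnFun.continuousSMul_induced_of_image_bounded ℝ E ℝ (BoundedDual E)
    (toFunLin : BoundedDual E →ₗ[ℝ] (E → ℝ)) ⟨rfl⟩ (fun l _ hB => l.bounded hB)

theorem continuous_eval [ContinuousSMul ℝ E] (v : E) :
    Continuous (fun l : BoundedDual E => l v) := by
  have h := UniformOnFun.uniformContinuous_eval_of_mem (β := ℝ)
    (𝔖 := {B : Set E | Bornology.IsVonNBounded ℝ B}) (Set.mem_singleton v)
    (Bornology.isVonNBounded_singleton v)
  exact h.continuous.comp continuous_induced_dom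

end BoundedDual

variable {E}

/-- The canonical linear map `i : E → E**`, `i v l = l v`, into the bidual. -/
def toBidual [ContinuousSMul ℝ E] : E →ₗ[ℝ] BoundedDual (BoundedDual E) where
  toFun v := ⟨{ toFun := fun l => l v
                map_add' := fun _ _ => rfl
                map_smul' := fun _ _ => rfl },
    fun _ hB => hB.image
      (⟨{ toFun := fun l => l v
          map_add' := fun _ _ => rfl
          map_smul' := fun _ _ => rfl }, BoundedDual.continuous_eval v⟩ : BoundedDual E →L[ℝ] ℝ)⟩
  map_add' v w := BoundedDual.ext fun l => map_add (BoundedDual.toLin l) v w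
  map_smul' r v := BoundedDual.ext fun l => map_smul (BoundedDual.toLin l) r v

/-- `L²_skew(E; ℝ)`: the bounded skew-symmetric bilinear forms on `E`. -/
structure BoundedSkewForm (E : Type*) [AddCommGroup E] [Module ℝ E] [TopologicalSpace E] where
  toBilin : E →ₗ[ℝ] E →ₗ[ℝ] ℝ
  skew : ∀ X Y, toBilin X Y = -toBilin Y X
  bounded : ∀ A B : Set E, Bornology.IsVonNBounded ℝ A → Bornology.IsVonNBounded ℝ B →
    Bornology.IsVonNBounded ℝ (Set.image2 (fun X Y => toBilin X Y) A B)

instance : CoeFun (BoundedSkewForm E) (fun _ => E → E → ℝ) := ⟨fun ω X Y => ω.toBilin X Y⟩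

end Dual

/-! ### The candidate for the Lie-Poisson structure, and the three conditions -/

section LiePoisson

variable {𝔤 : Type*} [LieRing 𝔤] [LieAlgebra ℝ 𝔤] [TopologicalSpace 𝔤] [ConvenientLieAlgebra 𝔤]

/-- The dual map `P : 𝔤* → L²_skew(𝔤; ℝ)` of the Lie bracket, `P_x(X, Y) = ⟨[X, Y], x⟩`. -/
def liePoisson (x : BoundedDual 𝔤) : BoundedSkewForm 𝔤 where
  toBilin := LinearMap.mk₂ ℝ (fun X Y => x ⁅X, Y⁆)
    (fun X X' Y => by rw [add_lie, map_add]) (fun r X Y => by rw [smul_lie, map_smul])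
    (fun X Y Y' => by rw [lie_add, map_add]) (fun r X Y => by rw [lie_smul, map_smul])
  skew X Y := by
    simp only [LinearMap.mk₂_apply]
    rw [← lie_skew, map_neg]
  bounded A B hA hB := by
    have h := x.bounded (ConvenientLieAlgebra.bounded_bracket A B hA hB)
    rwa [Set.image_image2] at h

/-- `df : 𝔤* → 𝔤**` factors as `i ∘ g` with a smooth mapping `g : 𝔤* → 𝔤`. -/
def DifferentialFactorsSmoothly (f : BoundedDual 𝔤 → ℝ) : Prop :=
  ∃ g : BoundedDual 𝔤 → 𝔤, IsSmoothMap g ∧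
    ∀ x y : BoundedDual 𝔤, toBidual (g x) y = differential f x y

/-- With `n = k + 1`: the `n`-th derivative of `f`, regarded as a function of its `j`-th entry
alone, is (the image in `𝔤**` of) an element of `𝔤`, which depends smoothly on the base point `x`
and on the other `k` entries `y`. -/
def DerivativeEntryLiesIn (f : BoundedDual 𝔤 → ℝ) (k : ℕ) (j : Fin (k + 1)) : Prop :=
  ∃ G : BoundedDual 𝔤 × (Fin k → BoundedDual 𝔤) → 𝔤, IsSmoothMap G ∧
    ∀ (x : BoundedDual 𝔤) (y : Fin k → BoundedDual 𝔤) (z : BoundedDual 𝔤),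
      toBidual (G (x, y)) z = iteratedDifferential f (k + 1) x (j.insertNth z y)

/-- `X` is the `P`-gradient `P ∘ df` of `f`: for each `x` the differential `df_x` lies in `𝔤`, and
`P_x(df_x, y) = ⟨y, X x⟩` for all `y` in `𝔤`. -/
def IsPGradient (f : BoundedDual 𝔤 → ℝ) (X : BoundedDual 𝔤 → BoundedDual 𝔤) : Prop :=
  ∀ x : BoundedDual 𝔤, ∃ v : 𝔤, (∀ y : BoundedDual 𝔤, toBidual v y = differential f x y) ∧
    ∀ y : 𝔤, liePoisson x v y = X x y

end LiePoisson

end Convenient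

end

/-! The equivalence is differentiation under an evaluation. If `df = i ∘ g` with `g` smooth, then
for each functional `z` the function `x ↦ df_x(z)` is `z ∘ g`. Hence `z(d^k g_x(y))` is `d^{k+1}
f_x` with `z` in the last entry, and symmetry of iterated derivatives moves `z` to any entry, so
`d^k g` is the required map. Conversely, only the first derivative in (2) is needed to recover `g`.
The `P`-gradient is `x ↦ P_x(g(x), ·)`, a bounded bilinear map evaluated along smooth maps.

The analysis lies in the word "smooth", which is only tested along curves. One needs `t ↦
df_{X(t)}(Y(t))` to be smooth and second derivatives to commute. Both concern `φ(t, s) = f(X(t) + s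
Y(t))`, a function on the plane that is smooth along smooth curves. Instead of the full theorem of
Boman, the argument shows only that `∂_s φ(t, 0)` is smooth in `t` (`SmoothAlong.contDiff_partial`)
and that the mixed partials agree (`SmoothAlong.deriv_comm`). Special curves bound pure directional
derivatives locally, polarization of difference operators turns this into bounds for mixed
differences, and these give locally uniform bounds on all `t`-derivatives of the difference
quotients in `s`.

Vector-valued statements are reduced to scalar ones: by Mackey's theorem weakly bounded sets are
bounded, and by Mackey completeness weakly smooth curves are smooth
(`isSmoothCurve_of_weakly_smooth`). Bounded maps need not be continuous, so they are differentiated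
along curves through a Taylor expansion with bounded remainder. -/

noncomputable section

namespace Convenient

open scoped ContDiff

/-! ### Special curves -/

section SpecialCurve

variable {V : Type*} [NormedAddCommGroup V] [NormedSpace ℝ V]

/-- Rescaling a bump by `2 ^ n` costs `2 ^ (n * k)` in its `k`-th derivative; the weight `2 ^ (-n²)`
beats this for every `k`, because `n (k + 1) ≤ (k + 1)² + n²` leaves a geometric series. -/
theorem summable_half_pow_sq_mul (k : ℕ) (M : ℝ) :
    Summable fun n : ℕ => (1 / 2 : ℝ) ^ (n * n) * (2 ^ n) ^ k * M := by
  refine Summable.mul_right M ?_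
  refine Summable.of_nonneg_of_le (fun n => by positivity) (fun n => ?_)
    (summable_geometric_two.mul_left (2 ^ ((k + 1) * (k + 1))))
  have h : n * k + n ≤ (k + 1) * (k + 1) + n * n := by
    have : n * (k + 1) ≤ (k + 1) * (k + 1) + n * n := by
      rcases Nat.le_total n (k + 1) with h | h <;> nlinarith
    linarith
  have h2 : (2 : ℝ) ^ (n * k + n) ≤ 2 ^ ((k + 1) * (k + 1) + n * n) :=
    pow_le_pow_right₀ (by norm_num) h
  rw [pow_add, pow_add] at h2
  rw [one_div, inv_pow, inv_pow, ← pow_mul]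
  field_simp
  linarith

theorem contDiff_tsum_bump [CompleteSpace V] {β : ℝ → ℝ} (hβ : ContDiff ℝ ∞ β)
    (hc : HasCompactSupport β) {a : ℕ → V} (ha : ∀ n, ‖a n‖ ≤ (1 / 2) ^ (n * n)) :
    ContDiff ℝ ∞ fun r => ∑' n, β (2 ^ n * r - 1) • a n := by
  have hb : ∀ k : ℕ, ∃ M : ℝ, ∀ x, ‖iteratedFDeriv ℝ k β x‖ ≤ M := fun k =>
    (hc.iteratedFDeriv k).exists_bound_of_continuous
      (hβ.continuous_iteratedFDeriv (mod_cast le_top))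
  choose M hM using hb
  have hsm : ∀ n : ℕ, ContDiff ℝ ∞ fun r : ℝ => β (2 ^ n * r - 1) := fun n =>
    hβ.comp ((contDiff_const.mul contDiff_id).sub contDiff_const)
  refine contDiff_tsum (N := ⊤) (v := fun k n => (1 / 2 : ℝ) ^ (n * n) * (2 ^ n) ^ k * M k)
    (fun n => (hsm n).smul contDiff_const) (fun k _ => summable_half_pow_sq_mul k (M k))
    (fun k n x _ => ?_)
  have h1 : ‖iteratedFDeriv ℝ k (fun r : ℝ => β (2 ^ n * r - 1)) x‖ ≤ (2 ^ n) ^ k * M k := by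
    rw [norm_iteratedFDeriv_eq_norm_iteratedDeriv]
    have h2 := iteratedDeriv_comp_const_smul (n := k) (f := fun y => β (y - 1))
      ((hβ.comp (contDiff_id.sub contDiff_const)).of_le (mod_cast le_top)) (2 ^ n)
    rw [h2]
    simp only [iteratedDeriv_comp_sub_const, norm_smul, norm_pow, Real.norm_ofNat]
    have h3 := hM k (2 ^ n * x - 1)
    rw [norm_iteratedFDeriv_eq_norm_iteratedDeriv] at h3
    gcongr
  have h4 := (ContinuousLinearMap.toSpanSingleton ℝ (a n)).norm_iteratedFDeriv_comp_left
    (f := fun r : ℝ => β (2 ^ n * r - 1)) (x := x) (n := k) (N := ∞) (hsm n).contDiffAt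
    (mod_cast le_top)
  have h5 : (ContinuousLinearMap.toSpanSingleton ℝ (a n)) ∘ (fun r : ℝ => β (2 ^ n * r - 1))
      = fun r => β (2 ^ n * r - 1) • a n := by ext r; simp
  rw [h5, ContinuousLinearMap.norm_toSpanSingleton] at h4
  calc _ ≤ _ := h4
    _ ≤ (1 / 2) ^ (n * n) * ((2 ^ n) ^ k * M k) := by
        gcongr
        exact ha n
    _ = _ := by ring

theorem exists_bump : ∃ b : ℝ → ℝ, ContDiff ℝ ∞ b ∧ HasCompactSupport b ∧
    (∀ u, |u| ≤ 1 / 8 → b u = 1) ∧ ∀ u, 1 / 4 ≤ |u| → b u = 0 := by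
  let b : ContDiffBump (0 : ℝ) := ⟨1 / 8, 1 / 4, by norm_num, by norm_num⟩
  refine ⟨b, b.contDiff, b.hasCompactSupport, fun u hu => ?_, fun u hu => ?_⟩
  · exact b.one_of_mem_closedBall (by simpa [b, Real.norm_eq_abs] using hu)
  · exact b.zero_of_le_dist (by simpa [b, Real.norm_eq_abs] using hu)

/-- Near `2⁻ⁿ` one has `7/8 < 2 ^ n * r < 9/8`; doubling or halving at least once moves this to
distance at least `1/4` from `1`, so all other terms vanish. -/
theorem tsum_bump_eventuallyEq {β : ℝ → ℝ} (h0 : ∀ u, 1 / 4 ≤ |u| → β u = 0) (a : ℕ → V) (n : ℕ) :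
    ∀ᶠ r in 𝓝 ((1 / 2 : ℝ) ^ n), ∑' m, β (2 ^ m * r - 1) • a m = β (2 ^ n * r - 1) • a n := by
  have hU : {r : ℝ | |2 ^ n * r - 1| < 1 / 8} ∈ 𝓝 ((1 / 2 : ℝ) ^ n) := by
    refine (isOpen_lt (by fun_prop) continuous_const).mem_nhds ?_
    simp
  filter_upwards [hU] with r hr
  refine tsum_eq_single n fun m hm => ?_
  rw [h0, zero_smul]
  simp only [abs_lt] at hr
  rcases lt_or_gt_of_ne hm with h | h
  · obtain ⟨d, rfl⟩ := Nat.exists_eq_add_of_lt h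
    have hd : (1 : ℝ) ≤ 2 ^ d := one_le_pow₀ (by norm_num)
    rw [le_abs]; right
    rw [pow_add, pow_add] at hr
    have h2 : (0 : ℝ) < 2 ^ m * r := by
      by_contra hneg
      push Not at hneg
      nlinarith [mul_nonneg (neg_nonneg.2 hneg) (zero_le_one.trans hd)]
    nlinarith
  · obtain ⟨d, rfl⟩ := Nat.exists_eq_add_of_lt h
    have hd : (1 : ℝ) ≤ 2 ^ d := one_le_pow₀ (by norm_num)
    rw [le_abs]; left
    rw [pow_add, pow_add]
    nlinarith

/-- A smooth curve that runs along the line `q ↦ a n + q • d n` near the time `2⁻ⁿ`. -/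
theorem exists_special_curve [CompleteSpace V] (x : V) {a d : ℕ → V}
    (ha : ∀ n, ‖a n - x‖ ≤ (1 / 2) ^ (n * n)) (hd : ∀ n, ‖d n‖ ≤ (1 / 2) ^ (n * n)) :
    ∃ c : ℝ → V, ContDiff ℝ ∞ c ∧
      ∀ n : ℕ, ∀ᶠ r in 𝓝 ((1 / 2 : ℝ) ^ n), c r = a n + (2 ^ n * r - 1) • d n := by
  obtain ⟨b, hb, hbc, hb1, hb0⟩ := exists_bump
  -- The first series places the curve at `a n`; the second uses the profile `u * b u`, which equals
  -- `u` on the plateau of `b`, to produce linear motion along `d n`.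
  refine ⟨fun r => x + (∑' n, b (2 ^ n * r - 1) • (a n - x))
    + ∑' n, (fun u => u * b u) (2 ^ n * r - 1) • d n, ?_, fun n => ?_⟩
  · exact (contDiff_const.add (contDiff_tsum_bump hb hbc ha)).add
      (contDiff_tsum_bump (contDiff_id.mul hb) hbc.mul_left hd)
  · have hU : {r : ℝ | |2 ^ n * r - 1| < 1 / 8} ∈ 𝓝 ((1 / 2 : ℝ) ^ n) := by
      refine (isOpen_lt (by fun_prop) continuous_const).mem_nhds ?_
      simp
    filter_upwards [hU, tsum_bump_eventuallyEq hb0 (fun n => a n - x) n,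
      tsum_bump_eventuallyEq (β := fun u => u * b u) (fun u hu => by simp [hb0 u hu]) d n]
      with r hr h1 h2
    rw [h1, h2]
    have := hb1 _ (le_of_lt hr)
    simp only [this, one_smul, mul_one]
    abel

end SpecialCurve

/-! ### Functions on the plane that are smooth along smooth curves -/

section Boman

variable {V : Type*} [NormedAddCommGroup V] [NormedSpace ℝ V]

/-- A scalar function on a normed space that is smooth along all smooth curves. -/
def SmoothAlong (φ : V → ℝ) : Prop :=
  ∀ c : ℝ → V, ContDiff ℝ ∞ c → ContDiff ℝ ∞ (fun r => φ (c r))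

theorem SmoothAlong.line {φ : V → ℝ} (hφ : SmoothAlong φ) (x v : V) :
    ContDiff ℝ ∞ fun q : ℝ => φ (x + q • v) :=
  hφ _ (contDiff_const.add (contDiff_id.smul contDiff_const))

/-- If the bound failed, points `a n` converging rapidly to `x` with huge `p`-th derivatives could
be threaded on one smooth curve. The composite with `φ` would then have `p`-th derivative larger
than `n` at `2⁻ⁿ`, contradicting its continuity on `[0, 1]`. -/
theorem SmoothAlong.locally_bounded [CompleteSpace V] {φ : V → ℝ} (hφ : SmoothAlong φ)
    (p : ℕ) (v x : V) :
    ∃ ε > 0, ∃ M : ℝ, ∀ y, ‖y - x‖ ≤ ε →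
      |iteratedDeriv p (fun q : ℝ => φ (y + q • v)) 0| ≤ M := by
  by_contra! hcon
  -- The denominator makes `lam n • v` small enough for the special curve. The chain rule then
  -- contributes the factor `(2 ^ n * lam n) ^ p`, which the choice of `a n` compensates.
  set lam : ℕ → ℝ := fun n => (1 / 2) ^ (n * n) / (1 + ‖v‖) with hlam
  have hlam0 : ∀ n, 0 < lam n := fun n => by positivity
  choose a ha hbig using fun n : ℕ => hcon ((1 / 2) ^ (n * n)) (by positivity)
    (n / (2 ^ n * lam n) ^ p)
  obtain ⟨c, hc, hcl⟩ := exists_special_curve x (a := a) (d := fun n => lam n • v) ha (fun n => by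
    rw [norm_smul, Real.norm_of_nonneg (hlam0 n).le, hlam]
    simp only
    rw [div_mul_eq_mul_div, div_le_iff₀ (by positivity)]
    gcongr
    linarith)
  have hsm := hφ c hc
  have hcont : Continuous (iteratedDeriv p fun r => φ (c r)) :=
    hsm.continuous_iteratedDeriv p (mod_cast le_top)
  obtain ⟨M, hM⟩ := isCompact_Icc.exists_bound_of_continuousOn (s := Icc (0 : ℝ) 1)
    hcont.continuousOn
  obtain ⟨n, hn⟩ := exists_nat_gt M
  have h1 := hM ((1 / 2) ^ n) ⟨by positivity, pow_le_one₀ (by norm_num) (by norm_num)⟩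
  have h2 : (fun r => φ (c r)) =ᶠ[𝓝 ((1 / 2 : ℝ) ^ n)]
      fun r => φ (a n + ((2 ^ n * lam n) * r - lam n) • v) := by
    filter_upwards [hcl n] with r hr
    rw [hr, smul_smul]
    congr 3
    ring
  rw [h2.iteratedDeriv_eq] at h1
  have h3 := iteratedDeriv_comp_const_smul (n := p) (f := fun y => φ (a n + (y - lam n) • v))
      ((hφ _ (contDiff_const.add ((contDiff_id.sub contDiff_const).smul contDiff_const))).of_le
        (mod_cast le_top)) (2 ^ n * lam n)
  rw [h3] at h1
  have h4 := iteratedDeriv_comp_sub_const p (fun q : ℝ => φ (a n + q • v)) (lam n)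
  have h5 : 2 ^ n * lam n * (1 / 2) ^ n - lam n = 0 := by
    rw [one_div, inv_pow]; field_simp; ring
  rw [h4] at h1
  simp only [h5] at h1
  have h6 := hbig n
  have hpos : 0 < (2 ^ n * lam n) ^ p := by have := hlam0 n; positivity
  rw [div_lt_iff₀ hpos] at h6
  rw [norm_smul, Real.norm_of_nonneg hpos.le, Real.norm_eq_abs] at h1
  linarith

theorem SmoothAlong.bounded_on_ball [FiniteDimensional ℝ V] {φ : V → ℝ} (hφ : SmoothAlong φ)
    (p : ℕ) (v : V) (R : ℝ) :
    ∃ M : ℝ, ∀ y, ‖y‖ ≤ R → |iteratedDeriv p (fun q : ℝ => φ (y + q • v)) 0| ≤ M := by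
  have := FiniteDimensional.complete ℝ V
  have := FiniteDimensional.proper ℝ V
  have h := (isCompact_closedBall (0 : V) R).induction_on
    (p := fun s => ∃ M : ℝ, ∀ y ∈ s, |iteratedDeriv p (fun q : ℝ => φ (y + q • v)) 0| ≤ M)
    ⟨0, by simp⟩ (fun s t hst ⟨M, hM⟩ => ⟨M, fun y hy => hM y (hst hy)⟩)
    (fun s t ⟨M, hM⟩ ⟨N, hN⟩ => ⟨max M N, fun y hy => by
      rcases hy with hy | hy
      · exact (hM y hy).trans (le_max_left _ _)
      · exact (hN y hy).trans (le_max_right _ _)⟩)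
    (fun x _ => by
      obtain ⟨ε, hε, M, hM⟩ := hφ.locally_bounded p v x
      exact ⟨Metric.closedBall x ε, mem_nhdsWithin_of_mem_nhds (Metric.closedBall_mem_nhds x hε),
        M, fun y hy => hM y (by simpa [dist_eq_norm] using hy)⟩)
  obtain ⟨M, hM⟩ := h
  exact ⟨M, fun y hy => hM y (by simpa using hy)⟩

end Boman

/-! ### Iterated differences -/

section Differences

/-- The difference of a function of one variable. -/
def stepDiff (h : ℝ) (u : ℝ → ℝ) (t : ℝ) : ℝ := u (t + h) - u t

/-- The iterated difference with steps `h 0, …, h (k - 1)`. -/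
def stepDiffs (h : ℕ → ℝ) : ℕ → (ℝ → ℝ) → ℝ → ℝ
  | 0, u => u
  | k + 1, u => stepDiffs h k (stepDiff (h k) u)

/-- One application of the mean value theorem per step, since differentiation commutes with
differences. -/
theorem stepDiffs_eq_iteratedDeriv {h : ℕ → ℝ} (hh : ∀ r, 0 < h r) (k : ℕ) {u : ℝ → ℝ}
    (hu : ContDiff ℝ ∞ u) (t : ℝ) :
    ∃ ξ ∈ Icc t (t + ∑ r ∈ Finset.range k, h r),
      stepDiffs h k u t = (∏ r ∈ Finset.range k, h r) * iteratedDeriv k u ξ := by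
  induction k generalizing u with
  | zero => exact ⟨t, by simp, by simp [stepDiffs]⟩
  | succ k ih =>
    have hshift : ContDiff ℝ ∞ fun t => u (t + h k) := hu.comp (contDiff_id.add contDiff_const)
    obtain ⟨ξ, hξ, he⟩ := ih (u := stepDiff (h k) u) (hshift.sub hu)
    have hd : Differentiable ℝ (iteratedDeriv k u) :=
      hu.differentiable_iteratedDeriv k (mod_cast WithTop.coe_lt_top k)
    obtain ⟨η, hη, hs⟩ := exists_deriv_eq_slope (iteratedDeriv k u)
      (lt_add_of_pos_right ξ (hh k)) hd.continuous.continuousOn hd.differentiableOn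
    refine ⟨η, ⟨hξ.1.trans hη.1.le, ?_⟩, ?_⟩
    · rw [Finset.sum_range_succ]
      linarith [hξ.2, hη.2]
    · have h1 : iteratedDeriv k (stepDiff (h k) u) ξ
          = iteratedDeriv k u (ξ + h k) - iteratedDeriv k u ξ := by
        have h2 := iteratedDeriv_fun_sub (n := k) (x := ξ) (f := fun t => u (t + h k)) (g := u)
          (hshift.of_le (mod_cast le_top)).contDiffAt (hu.of_le (mod_cast le_top)).contDiffAt
        rw [iteratedDeriv_comp_add_const] at h2
        exact h2
      rw [add_sub_cancel_left, eq_div_iff (hh k).ne'] at hs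
      rw [stepDiffs, he, h1, iteratedDeriv_succ, Finset.prod_range_succ, ← hs]
      ring

variable {V : Type*} [AddCommGroup V]

/-- The group algebra of `V` acts on functions on `V` by translations. -/
def translationAction : AddMonoidAlgebra ℝ V →ₐ[ℝ] Module.End ℝ (V → ℝ) :=
  AddMonoidAlgebra.lift ℝ (Module.End ℝ (V → ℝ)) V
    { toFun := fun h => LinearMap.funLeft ℝ ℝ fun x => x + h.toAdd
      map_one' := by ext φ x; simp [LinearMap.funLeft_apply]
      map_mul' := fun h k => by
        ext φ x
        simp only [LinearMap.funLeft_apply, toAdd_mul, Module.End.mul_apply]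
        congr 1
        abel }

/-- The translation by `h` as an element of the group algebra. -/
def translation (h : V) : AddMonoidAlgebra ℝ V := AddMonoidAlgebra.single h 1

theorem translationAction_translation (h : V) (φ : V → ℝ) (x : V) :
    translationAction (translation h) φ x = φ (x + h) := by
  rw [translationAction, translation, AddMonoidAlgebra.lift_single]
  simp [LinearMap.funLeft_apply]

theorem translation_add (h k : V) : translation (h + k) = translation h * translation k := by
  simp [translation, AddMonoidAlgebra.single_mul_single]

theorem translation_zero : translation (0 : V) = 1 := rfl

theorem translation_sum {ι : Type*} (s : Finset ι) (h : ι → V) :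
    translation (∑ i ∈ s, h i) = ∏ i ∈ s, translation (h i) := by
  classical
  induction s using Finset.induction_on with
  | empty => simp [translation_zero]
  | insert i s hi ih => rw [Finset.sum_insert hi, Finset.prod_insert hi, translation_add, ih]

theorem translation_nsmul (n : ℕ) (h : V) : translation (n • h) = translation h ^ n := by
  simpa using translation_sum (Finset.range n) fun _ => h

theorem translationAction_translation_mul (h : V) (a : AddMonoidAlgebra ℝ V) (φ : V → ℝ) (x : V) :
    translationAction (translation h * a) φ x = translationAction a φ (x + h) := by
  rw [map_mul, Module.End.mul_apply, translationAction_translation]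

theorem translationAction_prod [Module ℝ V] (h : ℕ → ℝ) (v : V) (k : ℕ) (φ : V → ℝ) (x : V) :
    translationAction (∏ r ∈ Finset.range k, (translation (h r • v) - 1)) φ x
      = stepDiffs h k (fun q => φ (x + q • v)) 0 := by
  induction k generalizing φ with
  | zero => simp [stepDiffs]
  | succ k ih =>
    rw [Finset.prod_range_succ, map_mul, Module.End.mul_apply, ih, stepDiffs]
    congr 1
    ext q
    rw [map_sub, LinearMap.sub_apply, map_one, Module.End.one_apply, Pi.sub_apply,
      translationAction_translation, stepDiff, add_smul, add_assoc]

/-- Polarization: a product of differences in various directions is an alternating sum of powers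
of differences. -/
theorem prod_translation_sub_one (n : ℕ) (g : ℕ → V) :
    ∏ r ∈ Finset.range n, (translation ((r + 1) • g r) - 1) =
      ∑ T ∈ (Finset.range n).powerset, (-1) ^ T.card * (translation (∑ r ∈ T, (r + 1) • g r) *
        (translation (-∑ r ∈ T, g r) - 1) ^ n) := by
  -- Expand the `n`-th power binomially; the `m`-th term translates by `(r + 1 - m) • g r` for each
  -- `r ∈ T`. The alternating sum over `T` then factors into a product over `r`.
  have h1 : ∀ T : Finset ℕ, translation (∑ r ∈ T, (r + 1) • g r) *
        (translation (-∑ r ∈ T, g r) - 1) ^ n = ∑ m ∈ Finset.range (n + 1),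
        ((-1) ^ (n - m) * (n.choose m : AddMonoidAlgebra ℝ V)) *
          ∏ r ∈ T, translation (((r : ℤ) + 1 - m) • g r) := by
    intro T
    rw [sub_eq_add_neg, add_pow, Finset.mul_sum]
    refine Finset.sum_congr rfl fun m _ => ?_
    rw [← translation_nsmul, ← translation_sum]
    have : (∑ r ∈ T, ((r : ℤ) + 1 - m) • g r)
        = (∑ r ∈ T, (r + 1) • g r) + m • (-∑ r ∈ T, g r) := by
      rw [smul_neg, Finset.smul_sum, ← sub_eq_add_neg, ← Finset.sum_sub_distrib]
      refine Finset.sum_congr rfl fun r _ => ?_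
      rw [sub_smul, natCast_zsmul]
      congr 1
      exact_mod_cast natCast_zsmul (g r) (r + 1)
    rw [this, translation_add]
    ring
  have h2 : ∀ m : ℕ, ∑ T ∈ (Finset.range n).powerset, (-1) ^ T.card *
      ∏ r ∈ T, translation (((r : ℤ) + 1 - m) • g r)
      = ∏ r ∈ Finset.range n, (1 - translation (((r : ℤ) + 1 - m) • g r)) := by
    intro m
    rw [Finset.prod_sub]
    simp
  simp_rw [h1, Finset.mul_sum]
  rw [Finset.sum_comm]
  have h3 : ∀ m : ℕ, ∑ T ∈ (Finset.range n).powerset, (-1) ^ T.card *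
      (((-1) ^ (n - m) * (n.choose m : AddMonoidAlgebra ℝ V)) *
          ∏ r ∈ T, translation (((r : ℤ) + 1 - m) • g r))
      = ((-1) ^ (n - m) * (n.choose m : AddMonoidAlgebra ℝ V)) *
        ∏ r ∈ Finset.range n, (1 - translation (((r : ℤ) + 1 - m) • g r)) := by
    intro m
    rw [← h2, Finset.mul_sum]
    exact Finset.sum_congr rfl fun T _ => by ring
  simp_rw [h3]
  -- For `1 ≤ m ≤ n` the factor with `r = m - 1` has translation zero and kills the product. This is
  -- why the steps carry the weights `r + 1`.
  rw [Finset.sum_eq_single 0]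
  · have h4 : ∀ r : ℕ, ((r : ℤ) + 1 - (0 : ℕ)) • g r = (r + 1) • g r := fun r => by
      rw [Nat.cast_zero, sub_zero]
      exact_mod_cast natCast_zsmul (g r) (r + 1)
    simp_rw [h4]
    rw [Nat.sub_zero, Nat.choose_zero_right, Nat.cast_one, mul_one]
    conv_rhs => rw [← Finset.card_range n, ← Finset.prod_const, Finset.card_range,
      ← Finset.prod_mul_distrib]
    exact Finset.prod_congr rfl fun r _ => by ring
  · intro m hm hm0
    rw [Finset.prod_eq_zero (i := m - 1), mul_zero]
    · simp only [Finset.mem_range] at hm ⊢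
      omega
    · have : (((m - 1 : ℕ) : ℤ) + 1 - m) = 0 := by omega
      rw [this, zero_smul, translation_zero, sub_self]
  · simp

end Differences

/-! ### Bounds for pure and mixed differences -/

section Boman

variable {V : Type*} [NormedAddCommGroup V] [NormedSpace ℝ V] [FiniteDimensional ℝ V]

theorem SmoothAlong.pow_difference_bound {φ : V → ℝ} (hφ : SmoothAlong φ) (n : ℕ) (v : V) (R : ℝ) :
    ∃ M : ℝ, ∀ y, ‖y‖ ≤ R → ∀ δ : ℝ, 0 < δ → δ ≤ 1 →
      |translationAction ((translation (δ • v) - 1) ^ n) φ y| ≤ M * δ ^ n := by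
  -- The mean value point is `y + ξ • v` with `0 ≤ ξ ≤ n * δ ≤ n`, hence the enlarged radius.
  obtain ⟨M, hM⟩ := hφ.bounded_on_ball n v (R + n * ‖v‖)
  refine ⟨M, fun y hy δ hδ hδ1 => ?_⟩
  have h := translationAction_prod (fun _ => δ) v n φ y
  rw [Finset.prod_const, Finset.card_range] at h
  obtain ⟨ξ, hξ, he⟩ := stepDiffs_eq_iteratedDeriv (h := fun _ => δ) (fun _ => hδ) n
    (hφ.line y v) 0
  rw [Finset.prod_const, Finset.card_range] at he
  have h2 : iteratedDeriv n (fun q : ℝ => φ (y + q • v)) ξ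
      = iteratedDeriv n (fun q : ℝ => φ ((y + ξ • v) + q • v)) 0 := by
    have := congrFun (iteratedDeriv_comp_add_const n (fun q : ℝ => φ (y + q • v)) ξ) 0
    simp only [zero_add] at this
    rw [← this]
    congr 1
    ext q
    rw [add_comm q, add_smul, add_assoc]
  rw [h, he, h2, abs_mul, abs_of_pos (pow_pos hδ n), mul_comm]
  refine mul_le_mul_of_nonneg_right (hM _ ?_) (pow_pos hδ n).le
  simp only [Finset.sum_const, Finset.card_range, nsmul_eq_mul, zero_add, mem_Icc] at hξ
  refine (norm_add_le _ _).trans (add_le_add hy ?_)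
  rw [norm_smul, Real.norm_of_nonneg hξ.1]
  refine mul_le_mul_of_nonneg_right (hξ.2.trans ?_) (norm_nonneg v)
  exact mul_le_of_le_one_right (Nat.cast_nonneg n) hδ1

/-- By `prod_translation_sub_one`, the mixed difference is a signed sum over `T` of pure differences
in the direction `-∑ r ∈ T, w r`, based at points shifted by at most `‖∑ r ∈ T, (r + 1) • w r‖`. -/
theorem SmoothAlong.mixed_difference_bound {φ : V → ℝ} (hφ : SmoothAlong φ) (n : ℕ) (w : ℕ → V)
    (R : ℝ) : ∃ M : ℝ, ∀ y, ‖y‖ ≤ R → ∀ δ : ℝ, 0 < δ → δ ≤ 1 →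
      |translationAction (∏ r ∈ Finset.range n, (translation ((r + 1) • δ • w r) - 1)) φ y|
        ≤ M * δ ^ n := by
  choose M hM using fun T : Finset ℕ => hφ.pow_difference_bound n (-∑ r ∈ T, w r)
    (R + ‖∑ r ∈ T, (r + 1) • w r‖)
  refine ⟨∑ T ∈ (Finset.range n).powerset, M T, fun y hy δ hδ hδ1 => ?_⟩
  rw [prod_translation_sub_one, map_sum, LinearMap.sum_apply, Finset.sum_apply, Finset.sum_mul]
  refine (Finset.abs_sum_le_sum_abs _ _).trans (Finset.sum_le_sum fun T _ => ?_)
  have hs : |translationAction ((-1) ^ T.card * (translation (∑ r ∈ T, (r + 1) • δ • w r) *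
        (translation (-∑ r ∈ T, δ • w r) - 1) ^ n)) φ y|
      = |translationAction (translation (∑ r ∈ T, (r + 1) • δ • w r) *
        (translation (-∑ r ∈ T, δ • w r) - 1) ^ n) φ y| := by
    rcases neg_one_pow_eq_or (AddMonoidAlgebra ℝ V) T.card with h | h <;> rw [h]
    · rw [one_mul]
    · rw [neg_one_mul, map_neg, LinearMap.neg_apply, Pi.neg_apply, abs_neg]
  rw [hs, translationAction_translation_mul, ← Finset.smul_sum, ← smul_neg]
  refine hM T _ ((norm_add_le _ _).trans (add_le_add hy ?_)) δ hδ hδ1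
  have : ∑ r ∈ T, (r + 1) • δ • w r = δ • ∑ r ∈ T, (r + 1) • w r := by
    rw [Finset.smul_sum]
    exact Finset.sum_congr rfl fun r _ => smul_comm _ _ _
  rw [this, norm_smul, Real.norm_of_nonneg hδ.le]
  exact mul_le_of_le_one_left (norm_nonneg _) hδ1

end Boman

/-! ### Limits of functions with bounded derivatives -/

section Limits

theorem abs_taylor_le {u : ℝ → ℝ} (hu : ContDiff ℝ ∞ u) {t C h : ℝ} (hh : |h| ≤ 1)
    (hC : ∀ s, |s - t| ≤ 1 → |deriv (deriv u) s| ≤ C) :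
    |u (t + h) - u t - h * deriv u t| ≤ C * h ^ 2 := by
  have hd : Differentiable ℝ u := (contDiff_infty_iff_deriv.1 hu).1
  have hu' := (contDiff_infty_iff_deriv.1 hu).2
  have hd' : Differentiable ℝ (deriv u) := (contDiff_infty_iff_deriv.1 hu').1
  have hball : ∀ s, s ∈ Metric.closedBall t |h| ↔ |s - t| ≤ |h| := fun s => by
    rw [Metric.mem_closedBall, Real.dist_eq]
  have h1 : ∀ s ∈ Metric.closedBall t |h|, |deriv u s - deriv u t| ≤ C * |h| := by
    intro s hs
    have hC0 : 0 ≤ C := (abs_nonneg _).trans (hC t (by simp))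
    have := Convex.norm_image_sub_le_of_norm_deriv_le (f := deriv u) (x := t) (y := s) (C := C)
      (fun x _ => hd' x) (fun x hx => hC x (((hball x).1 hx).trans hh))
      (convex_closedBall t |h|) (Metric.mem_closedBall_self (abs_nonneg h)) hs
    refine this.trans (mul_le_mul_of_nonneg_left ((hball s).1 hs) hC0)
  have h2 := Convex.norm_image_sub_le_of_norm_deriv_le (f := fun s => u s - s * deriv u t)
    (x := t) (y := t + h) (C := C * |h|)
    (fun x _ => (hd x).sub (differentiableAt_id.mul_const _))
    (fun x hx => by
      have : deriv (fun s => u s - s * deriv u t) x = deriv u x - deriv u t := by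
        have := ((hd x).hasDerivAt.sub ((hasDerivAt_id x).mul_const (deriv u t))).deriv
        rw [one_mul] at this
        exact this
      rw [this]
      exact h1 x hx)
    (convex_closedBall t |h|) (Metric.mem_closedBall_self (abs_nonneg h))
    ((hball _).2 (by simp))
  rw [Real.norm_eq_abs, Real.norm_eq_abs, add_sub_cancel_left, mul_assoc, abs_mul_abs_self] at h2
  rw [sq]
  convert h2 using 2
  ring

theorem hasDerivAt_of_abs_taylor_le {u : ℝ → ℝ} {t a C : ℝ}
    (h : ∀ h, |h| ≤ 1 → |u (t + h) - u t - h * a| ≤ C * h ^ 2) : HasDerivAt u a t := by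
  rw [hasDerivAt_iff_isLittleO_nhds_zero]
  have hO : (fun h => u (t + h) - u t - h • a) =O[𝓝 0] fun h : ℝ => h ^ 2 := by
    refine Asymptotics.IsBigO.of_bound C ?_
    filter_upwards [Metric.closedBall_mem_nhds (0 : ℝ) one_pos] with x hx
    have := h x (by simpa using hx)
    simpa using this
  exact hO.trans_isLittleO (Asymptotics.isLittleO_pow_id one_lt_two)

/-- The pointwise limit `ψ` of smooth functions whose derivatives are all locally bounded. -/
structure IsTameLimit (Ψ : ℕ → ℝ → ℝ) (ψ : ℝ → ℝ) : Prop where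
  smooth : ∀ n, ContDiff ℝ ∞ (Ψ n)
  bounded : ∀ (k : ℕ) (R : ℝ), ∃ C : ℝ, ∀ n t, |t| ≤ R → |iteratedDeriv k (Ψ n) t| ≤ C
  tendsto : ∀ t, Tendsto (fun n => Ψ n t) atTop (𝓝 (ψ t))

theorem IsTameLimit.taylor {Ψ : ℕ → ℝ → ℝ} {ψ : ℝ → ℝ} (H : IsTameLimit Ψ ψ) (t : ℝ) :
    ∃ C : ℝ, ∀ n h, |h| ≤ 1 → |Ψ n (t + h) - Ψ n t - h * deriv (Ψ n) t| ≤ C * h ^ 2 := by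
  obtain ⟨C, hC⟩ := H.bounded 2 (|t| + 1)
  refine ⟨C, fun n h hh => abs_taylor_le (H.smooth n) hh fun s hs => ?_⟩
  have := hC n s (by
    have := abs_add_le (s - t) t
    rw [sub_add_cancel] at this
    linarith)
  rwa [iteratedDeriv_succ, iteratedDeriv_one] at this

/-- The quotient with a fixed step `h` differs from the derivative by at most `C * h`, uniformly in
`n`. Pointwise convergence of the quotients therefore makes the derivatives Cauchy, and the Taylor
estimate survives in the limit. -/
theorem IsTameLimit.exists_deriv {Ψ : ℕ → ℝ → ℝ} {ψ : ℝ → ℝ} (H : IsTameLimit Ψ ψ) (t : ℝ) :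
    ∃ a, Tendsto (fun n => deriv (Ψ n) t) atTop (𝓝 a) ∧ HasDerivAt ψ a t := by
  obtain ⟨C, hC⟩ := H.taylor t
  have hC0 : 0 ≤ C := by
    have := (abs_nonneg _).trans (hC 0 1 (by simp))
    linarith
  have hcau : CauchySeq fun n => deriv (Ψ n) t := by
    rw [Metric.cauchySeq_iff']
    intro ε hε
    -- With this step the two Taylor errors take up less than `ε / 2` after division by `h`, leaving
    -- `ε / 2` for the values at `t` and `t + h`.
    set h : ℝ := min 1 (ε / (4 * (C + 1))) with hh
    have hpos : 0 < h := lt_min one_pos (by positivity)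
    have hle : h ≤ 1 := min_le_left _ _
    have hCh : 2 * C * h < ε / 2 := by
      have h1 : h ≤ ε / (4 * (C + 1)) := min_le_right _ _
      rw [le_div_iff₀ (by positivity)] at h1
      nlinarith
    have hc : CauchySeq fun n => Ψ n (t + h) - Ψ n t :=
      ((H.tendsto (t + h)).sub (H.tendsto t)).cauchySeq
    obtain ⟨N, hN⟩ := Metric.cauchySeq_iff'.1 hc (ε / 2 * h) (by positivity)
    refine ⟨N, fun n hn => ?_⟩
    have h1 := hN n hn
    have h2 := hC n h (by rwa [abs_of_pos hpos])
    have h3 := hC N h (by rwa [abs_of_pos hpos])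
    rw [Real.dist_eq] at h1 ⊢
    have h4 : |h * (deriv (Ψ n) t - deriv (Ψ N) t)| < h * ε := by
      have h5 : h * (deriv (Ψ n) t - deriv (Ψ N) t)
        = ((Ψ n (t + h) - Ψ n t) - (Ψ N (t + h) - Ψ N t))
          - (Ψ n (t + h) - Ψ n t - h * deriv (Ψ n) t)
          + (Ψ N (t + h) - Ψ N t - h * deriv (Ψ N) t) := by ring
      rw [h5]
      have h6 := abs_add_le (((Ψ n (t + h) - Ψ n t) - (Ψ N (t + h) - Ψ N t))
          - (Ψ n (t + h) - Ψ n t - h * deriv (Ψ n) t))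
          (Ψ N (t + h) - Ψ N t - h * deriv (Ψ N) t)
      have h7 := abs_sub ((Ψ n (t + h) - Ψ n t) - (Ψ N (t + h) - Ψ N t))
          (Ψ n (t + h) - Ψ n t - h * deriv (Ψ n) t)
      nlinarith
    rw [abs_mul, abs_of_pos hpos] at h4
    exact lt_of_mul_lt_mul_left h4 hpos.le
  obtain ⟨a, ha⟩ := cauchySeq_tendsto_of_complete hcau
  refine ⟨a, ha, hasDerivAt_of_abs_taylor_le (C := C) fun h hh => ?_⟩
  refine le_of_tendsto ((((H.tendsto (t + h)).sub (H.tendsto t)).sub (ha.const_mul h)).abs)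
    (Eventually.of_forall fun n => hC n h hh)

theorem IsTameLimit.tendsto_deriv {Ψ : ℕ → ℝ → ℝ} {ψ : ℝ → ℝ} (H : IsTameLimit Ψ ψ) (t : ℝ) :
    Tendsto (fun n => deriv (Ψ n) t) atTop (𝓝 (deriv ψ t)) := by
  obtain ⟨a, ha, hd⟩ := H.exists_deriv t
  rwa [hd.deriv]

theorem IsTameLimit.deriv {Ψ : ℕ → ℝ → ℝ} {ψ : ℝ → ℝ} (H : IsTameLimit Ψ ψ) :
    IsTameLimit (fun n => deriv (Ψ n)) (deriv ψ) where
  smooth n := (contDiff_infty_iff_deriv.1 (H.smooth n)).2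
  bounded k R := by
    obtain ⟨C, hC⟩ := H.bounded (k + 1) R
    exact ⟨C, fun n t ht => by simpa only [iteratedDeriv_succ'] using hC n t ht⟩
  tendsto := H.tendsto_deriv

theorem IsTameLimit.contDiff {Ψ : ℕ → ℝ → ℝ} {ψ : ℝ → ℝ} (H : IsTameLimit Ψ ψ) :
    ContDiff ℝ ∞ ψ := by
  rw [contDiff_infty]
  intro m
  induction m generalizing Ψ ψ with
  | zero =>
    exact contDiff_zero.2 (continuous_iff_continuousAt.2 fun t =>
      (H.exists_deriv t).choose_spec.2.continuousAt)
  | succ m ih =>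
    rw [Nat.cast_succ, contDiff_succ_iff_deriv]
    exact ⟨fun t => (H.exists_deriv t).choose_spec.2.differentiableAt, by simp, ih H.deriv⟩

end Limits

/-! ### Partial derivatives of functions that are smooth along smooth curves -/

section Boman

/-- Take `k` differences in `t` and one in `s`. Cutting `[0, s]` into `N + 1` equal pieces gives `N
+ 1` mixed differences of size at most `M * δ ^ (k + 1)` with `δ` proportional to `s / (N + 1)`.
Dividing by the `t`-steps bounds the `k`-th derivative by `M * s` at a point that tends to `t` as `N
→ ∞`. -/
theorem SmoothAlong.partial_difference_bound {φ : ℝ × ℝ → ℝ} (hφ : SmoothAlong φ) (k : ℕ) (R : ℝ) :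
    ∃ C : ℝ, ∀ t, |t| ≤ R → ∀ s, 0 < s → s ≤ 1 →
      |iteratedDeriv k (fun t => φ (t, s) - φ (t, 0)) t| ≤ C * s := by
  set w : ℕ → ℝ × ℝ := fun r => if r < k then (1, 0) else (0, 1) with hw
  obtain ⟨M, hM⟩ := hφ.mixed_difference_bound (k + 1) w (max R 1)
  refine ⟨M, fun t ht s hs hs1 => ?_⟩
  set u : ℝ → ℝ := fun t => φ (t, s) - φ (t, 0) with hu
  have hline : ∀ s : ℝ, ContDiff ℝ ∞ fun t => φ (t, s) := fun s =>
    hφ _ (contDiff_id.prodMk contDiff_const)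
  have hus : ContDiff ℝ ∞ u := (hline s).sub (hline 0)
  have key : ∀ N : ℕ, ∃ ξ ∈ Icc t (t + k * k / (N + 1)), |iteratedDeriv k u ξ| ≤ M * s := by
    intro N
    -- Polarization forces the last step, in direction `s`, to have length `(k + 1) * δ`; thus `N +
    -- 1` of them make up exactly `s`.
    set δ : ℝ := s / ((N + 1) * (k + 1)) with hδ
    have hδ0 : 0 < δ := by positivity
    have hδN : δ ≤ 1 / (N + 1) := by
      rw [hδ, div_le_div_iff₀ (by positivity) (by positivity)]
      have : (0 : ℝ) ≤ k := Nat.cast_nonneg k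
      nlinarith [mul_le_mul hs1 (le_refl ((N : ℝ) + 1)) (by positivity) zero_le_one,
        mul_nonneg (by positivity : (0 : ℝ) ≤ N + 1) this]
    have hδ1 : δ ≤ 1 := hδN.trans (by
      rw [div_le_one (by positivity)]; linarith [(Nat.cast_nonneg N : (0 : ℝ) ≤ N)])
    set h : ℕ → ℝ := fun r => (r + 1) * δ with hh
    set a : AddMonoidAlgebra ℝ (ℝ × ℝ) :=
      ∏ r ∈ Finset.range k, (translation (h r • ((1, 0) : ℝ × ℝ)) - 1) with ha
    set d : ℝ × ℝ := (k + 1) • δ • ((0, 1) : ℝ × ℝ) with hd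
    have hprod : ∏ r ∈ Finset.range (k + 1), (translation ((r + 1) • δ • w r) - 1)
        = a * (translation d - 1) := by
      rw [Finset.prod_range_succ, ha]
      congr 1
      · refine Finset.prod_congr rfl fun r hr => ?_
        rw [hw]
        simp only [if_pos (Finset.mem_range.1 hr), hh]
        rw [mul_smul, ← Nat.cast_succ, Nat.cast_smul_eq_nsmul]
      · simp [hw, hd]
    have hNd : (N + 1) • d = (0, s) := by
      rw [hd, ← mul_smul, ← Nat.cast_smul_eq_nsmul ℝ]
      ext
      · simp
      · simp only [Prod.smul_mk, smul_eq_mul, mul_one, hδ]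
        push_cast
        field_simp
    -- Telescoping in the variable `s`, written as a geometric sum in the group algebra.
    have hgeom : a * (translation ((0, s) : ℝ × ℝ) - 1)
        = ∑ i ∈ Finset.range (N + 1), translation (i • d) * (a * (translation d - 1)) := by
      simp_rw [translation_nsmul]
      rw [← Finset.sum_mul, mul_left_comm, geom_sum_mul, ← translation_nsmul, hNd]
    have h1 : translationAction (a * (translation ((0, s) : ℝ × ℝ) - 1)) φ (t, 0)
        = stepDiffs h k u t := by
      rw [map_mul, Module.End.mul_apply, ha, translationAction_prod]
      have hsh : ∀ (k : ℕ) (u : ℝ → ℝ) (q : ℝ),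
          stepDiffs h k (fun q => u (t + q)) q = stepDiffs h k u (t + q) := by
        intro k
        induction k with
        | zero => intro u q; rfl
        | succ k ih =>
          intro u q
          rw [stepDiffs, stepDiffs, ← ih]
          congr 1
          ext q
          simp [stepDiff, add_assoc]
      have := hsh k u 0
      rw [add_zero] at this
      rw [← this]
      congr 1
      ext q
      rw [map_sub, LinearMap.sub_apply, map_one, Module.End.one_apply, Pi.sub_apply,
        translationAction_translation, hu]
      simp
    have h2 : |stepDiffs h k u t| ≤ (N + 1) * (M * δ ^ (k + 1)) := by
      rw [← h1, hgeom, map_sum, LinearMap.sum_apply, Finset.sum_apply]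
      refine (Finset.abs_sum_le_sum_abs _ _).trans ?_
      have : ∀ i ∈ Finset.range (N + 1), |translationAction
          (translation (i • d) * (a * (translation d - 1))) φ (t, 0)| ≤ M * δ ^ (k + 1) := by
        intro i hi
        rw [translationAction_translation_mul, ← hprod]
        refine hM _ ?_ δ hδ0 hδ1
        have hid : (t, (0 : ℝ)) + i • d = (t, i * ((k + 1) * δ)) := by
          rw [hd]
          ext <;> simp
        rw [hid, Prod.norm_mk]
        refine max_le_max ht ?_
        rw [Real.norm_of_nonneg (by positivity), hδ]
        have hi' : (i : ℝ) ≤ N + 1 := by exact_mod_cast (Finset.mem_range.1 hi).le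
        calc (i : ℝ) * ((k + 1) * (s / ((N + 1) * (k + 1)))) = s * (i / (N + 1)) := by
              field_simp
          _ ≤ 1 * 1 := by
              refine mul_le_mul hs1 ?_ (by positivity) zero_le_one
              rwa [div_le_one (by positivity)]
          _ = 1 := one_mul 1
      refine (Finset.sum_le_sum this).trans ?_
      simp
    obtain ⟨ξ, hξ, he⟩ := stepDiffs_eq_iteratedDeriv (h := h) (fun r => by positivity) k hus t
    refine ⟨ξ, ⟨hξ.1, hξ.2.trans ?_⟩, ?_⟩
    · refine add_le_add le_rfl ?_
      have : ∀ r ∈ Finset.range k, h r ≤ k * (1 / (N + 1)) := fun r hr => by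
        have : (r : ℝ) + 1 ≤ k := by exact_mod_cast Finset.mem_range.1 hr
        exact mul_le_mul this hδN hδ0.le (Nat.cast_nonneg k)
      refine (Finset.sum_le_sum this).trans (le_of_eq ?_)
      simp only [Finset.sum_const, Finset.card_range, nsmul_eq_mul]
      ring
    · have hp : δ ^ k ≤ ∏ r ∈ Finset.range k, h r := by
        rw [← Finset.card_range k, ← Finset.prod_const, Finset.card_range]
        refine Finset.prod_le_prod (fun _ _ => hδ0.le) fun r _ => ?_
        simp only [hh]
        nlinarith [(Nat.cast_nonneg r : (0 : ℝ) ≤ r)]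
      rw [he, abs_mul, abs_of_nonneg ((pow_pos hδ0 k).le.trans hp)] at h2
      have h3 : δ ^ k * |iteratedDeriv k u ξ| ≤ δ ^ k * ((N + 1) * (M * δ)) := by
        calc _ ≤ _ := mul_le_mul_of_nonneg_right hp (abs_nonneg _)
          _ ≤ _ := h2
          _ = _ := by ring
      have h4 := le_of_mul_le_mul_left h3 (pow_pos hδ0 k)
      have hM0 : 0 ≤ M := by
        by_contra hneg
        push Not at hneg
        have : ((N : ℝ) + 1) * (M * δ) < 0 :=
          mul_neg_of_pos_of_neg (by positivity) (mul_neg_of_neg_of_pos hneg hδ0)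
        linarith [abs_nonneg (iteratedDeriv k u ξ)]
      refine h4.trans ?_
      have h5 : ((N : ℝ) + 1) * (M * δ) = M * (s / (k + 1)) := by
        rw [hδ]; field_simp
      rw [h5]
      refine mul_le_mul_of_nonneg_left ?_ hM0
      exact div_le_self hs.le (by linarith [(Nat.cast_nonneg k : (0 : ℝ) ≤ k)])
  choose ξ hξ hb using key
  have hlim : Tendsto ξ atTop (𝓝 t) := by
    refine tendsto_of_tendsto_of_tendsto_of_le_of_le tendsto_const_nhds ?_
      (fun N => (hξ N).1) (fun N => (hξ N).2)
    have := (tendsto_one_div_add_atTop_nhds_zero_nat (𝕜 := ℝ)).const_mul ((k : ℝ) * k)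
    simpa [div_eq_mul_inv] using this.const_add t
  have hcont : Continuous (iteratedDeriv k u) :=
    hus.continuous_iteratedDeriv k (mod_cast le_top)
  exact le_of_tendsto ((hcont.tendsto t).comp hlim).abs (Eventually.of_forall hb)

theorem SmoothAlong.isTameLimit_partial {φ : ℝ × ℝ → ℝ} (hφ : SmoothAlong φ) :
    IsTameLimit (fun n t => ((n : ℝ) + 1) * (φ (t, 1 / (n + 1)) - φ (t, 0)))
      fun t => deriv (fun s => φ (t, s)) 0 where
  smooth n := contDiff_const.mul ((hφ _ (contDiff_id.prodMk contDiff_const)).sub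
    (hφ _ (contDiff_id.prodMk contDiff_const)))
  bounded k R := by
    obtain ⟨C, hC⟩ := hφ.partial_difference_bound k R
    refine ⟨C, fun n t ht => ?_⟩
    have hn : (0 : ℝ) < n + 1 := by positivity
    have h := hC t ht (1 / (n + 1)) (by positivity) (by
      rw [div_le_one hn]; linarith [(Nat.cast_nonneg n : (0 : ℝ) ≤ n)])
    rw [iteratedDeriv_const_mul_field, abs_mul, abs_of_pos hn]
    calc _ ≤ ((n : ℝ) + 1) * (C * (1 / (n + 1))) := mul_le_mul_of_nonneg_left h hn.le
      _ = C := by field_simp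
  tendsto t := by
    have hd : HasDerivAt (fun s => φ (t, s)) (deriv (fun s => φ (t, s)) 0) 0 :=
      ((contDiff_infty_iff_deriv.1 (hφ _ (contDiff_const.prodMk contDiff_id))).1 0).hasDerivAt
    have h1 := hasDerivAt_iff_tendsto_slope_zero.1 hd
    have h2 : Tendsto (fun n : ℕ => 1 / ((n : ℝ) + 1)) atTop (𝓝[≠] 0) :=
      tendsto_nhdsWithin_iff.2 ⟨tendsto_one_div_add_atTop_nhds_zero_nat,
        Eventually.of_forall fun n => (by positivity : (0 : ℝ) < 1 / (n + 1)).ne'⟩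
    have h3 := h1.comp h2
    refine h3.congr fun n => ?_
    simp

theorem SmoothAlong.contDiff_partial {φ : ℝ × ℝ → ℝ} (hφ : SmoothAlong φ) :
    ContDiff ℝ ∞ fun t => deriv (fun s => φ (t, s)) 0 :=
  hφ.isTameLimit_partial.contDiff

/-- The mixed second partial derivatives agree. -/
theorem SmoothAlong.deriv_comm {φ : ℝ × ℝ → ℝ} (hφ : SmoothAlong φ) :
    deriv (fun t => deriv (fun s => φ (t, s)) 0) 0
      = deriv (fun s => deriv (fun t => φ (t, s)) 0) 0 := by
  have h1 := hφ.isTameLimit_partial.tendsto_deriv 0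
  have hsw : SmoothAlong fun x : ℝ × ℝ => φ (x.2, x.1) := fun c hc =>
    hφ _ (hc.snd.prodMk hc.fst)
  have hd : HasDerivAt (fun s => deriv (fun t => φ (t, s)) 0)
      (deriv (fun s => deriv (fun t => φ (t, s)) 0) 0) 0 :=
    ((contDiff_infty_iff_deriv.1 hsw.contDiff_partial).1 0).hasDerivAt
  have h2 : Tendsto (fun n : ℕ => 1 / ((n : ℝ) + 1)) atTop (𝓝[≠] 0) :=
    tendsto_nhdsWithin_iff.2 ⟨tendsto_one_div_add_atTop_nhds_zero_nat,
      Eventually.of_forall fun n => (by positivity : (0 : ℝ) < 1 / (n + 1)).ne'⟩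
  have h3 := (hasDerivAt_iff_tendsto_slope_zero.1 hd).comp h2
  -- One sequence has two limits: the `t`-derivatives at `0` of the quotients in `s` are also the
  -- quotients in `s` of `∂_t φ(0, s)`.
  refine tendsto_nhds_unique h1 (h3.congr fun n => ?_)
  have hdf : ∀ s : ℝ, DifferentiableAt ℝ (fun t => φ (t, s)) 0 := fun s =>
    (contDiff_infty_iff_deriv.1 (hφ _ (contDiff_id.prodMk contDiff_const))).1 0
  have h4 := (((hdf (1 / (n + 1))).hasDerivAt.sub (hdf 0).hasDerivAt).const_mul ((n : ℝ) + 1)).deriv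
  simp only [Pi.sub_apply] at h4
  rw [h4]
  simp

end Boman

/-! ### Bounded sets and continuous functionals -/

section Mackey

/-- The uniform boundedness principle on the complete dual of the seminormed space `(E, p)`, with
points of `S` acting by evaluation; Hahn-Banach recovers `p x` from a functional of norm at most
one. -/
theorem seminorm_bounded_of_dual_bounded {E : Type*} [AddCommGroup E] [Module ℝ E]
    (p : Seminorm ℝ E) (S : Set E)
    (h : ∀ l : E →ₗ[ℝ] ℝ, (∃ C, ∀ x, |l x| ≤ C * p x) → ∃ M, ∀ x ∈ S, |l x| ≤ M) :
    ∃ M, ∀ x ∈ S, p x ≤ M := by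
  let _ : SeminormedAddCommGroup E := p.toAddGroupSeminorm.toSeminormedAddCommGroup
  let _ : NormedSpace ℝ E := { norm_smul_le := fun r x => (map_smul_eq_mul p r x).le }
  have hp : ∀ x : E, ‖x‖ = p x := fun _ => rfl
  obtain ⟨M, hM⟩ := banach_steinhaus
    (g := fun x : S => NormedSpace.inclusionInDoubleDual ℝ E (x : E)) (fun l => by
      obtain ⟨M, hM⟩ := h l ⟨‖l‖, fun x => l.le_opNorm x⟩
      exact ⟨M, fun x => hM x x.2⟩)
  refine ⟨M, fun x hx => ?_⟩
  obtain ⟨l, hl, hlx⟩ := exists_dual_vector'' ℝ x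
  have h1 := (NormedSpace.inclusionInDoubleDual ℝ E x).le_of_opNorm_le (hM ⟨x, hx⟩) l
  rw [NormedSpace.dual_def, hlx] at h1
  have hM0 : 0 ≤ M := (norm_nonneg _).trans (hM ⟨x, hx⟩)
  simp only [RCLike.ofReal_real_eq_id, id, Real.norm_eq_abs, abs_norm] at h1
  rw [← hp]
  nlinarith

variable {E : Type*} [AddCommGroup E] [Module ℝ E] [TopologicalSpace E]
  [IsTopologicalAddGroup E] [ContinuousSMul ℝ E] [LocallyConvexSpace ℝ E]

/-- Mackey's theorem: weakly bounded sets are bounded. -/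
theorem isVonNBounded_of_dual_bounded {S : Set E}
    (h : ∀ l : E →L[ℝ] ℝ, ∃ M, ∀ x ∈ S, |l x| ≤ M) : Bornology.IsVonNBounded ℝ S := by
  rw [(PolynormableSpace.withSeminorms ℝ E).isVonNBounded_iff_seminorm_bounded]
  intro p
  obtain ⟨M, hM⟩ := seminorm_bounded_of_dual_bounded p.1 S fun l ⟨C, hC⟩ => by
    have hl : Continuous l := by
      refine (PolynormableSpace.withSeminorms ℝ E).continuous_of_isBounded
        (norm_withSeminorms ℝ ℝ) l fun _ => ⟨{p}, C.toNNReal, fun x => ?_⟩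
      simp only [Finset.sup_singleton, Seminorm.comp_apply, coe_normSeminorm, Real.norm_eq_abs,
        smul_apply]
      refine (hC x).trans ?_
      rw [NNReal.smul_def, smul_eq_mul]
      exact mul_le_mul_of_nonneg_right (Real.le_coe_toNNReal C) (apply_nonneg _ _)
    exact h ⟨l, hl⟩
  exact ⟨max M 0 + 1, by positivity, fun x hx => by
    have := hM x hx
    have := le_max_left M 0
    linarith⟩

end Mackey

/-! ### Smooth curves -/

section Curves

variable {E : Type*} [AddCommGroup E] [Module ℝ E] [TopologicalSpace E]
  {F : Type*} [AddCommGroup F] [Module ℝ F] [TopologicalSpace F]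
  {G : Type*} [AddCommGroup G] [Module ℝ G] [TopologicalSpace G]

/-- `v` is the limit of the difference quotients of the curve `c` at `t`. -/
def HasVelocity (c : ℝ → E) (v : E) (t : ℝ) : Prop :=
  Tendsto (fun h : ℝ => h⁻¹ • (c (t + h) - c t)) (𝓝[≠] 0) (𝓝 v)

theorem hasVelocity_real_iff {u : ℝ → ℝ} {a t : ℝ} : HasVelocity u a t ↔ HasDerivAt u a t :=
  hasDerivAt_iff_tendsto_slope_zero.symm

theorem HasVelocity.unique [T2Space E] {c : ℝ → E} {v w : E} {t : ℝ} (h : HasVelocity c v t)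
    (h' : HasVelocity c w t) : v = w :=
  tendsto_nhds_unique h h'

theorem HasVelocity.add [ContinuousAdd E] {c d : ℝ → E} {v w : E} {t : ℝ}
    (hc : HasVelocity c v t) (hd : HasVelocity d w t) :
    HasVelocity (fun r => c r + d r) (v + w) t := by
  refine (Tendsto.add hc hd).congr fun h => ?_
  change _ = h⁻¹ • ((c (t + h) + d (t + h)) - (c t + d t))
  rw [← smul_add, add_sub_add_comm]

theorem HasVelocity.clm (L : E →L[ℝ] F) {c : ℝ → E} {v : E} {t : ℝ} (hc : HasVelocity c v t) :
    HasVelocity (fun r => L (c r)) (L v) t := by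
  refine ((L.continuous.tendsto v).comp hc).congr fun h => ?_
  simp

theorem HasVelocity.smul_comp [IsTopologicalAddGroup E] [ContinuousSMul ℝ E] {c : ℝ → E} {v : E}
    {a σ : ℝ → ℝ} {a' σ' t : ℝ} (ha : HasDerivAt a a' t) (hσ : HasDerivAt σ σ' t)
    (hc : HasVelocity c v (σ t)) :
    HasVelocity (fun r => a r • c (σ r)) (a' • c (σ t) + (a t * σ') • v) t := by
  classical
  -- The quotient is extended continuously by `v` at `0`, because `σ (t + h) - σ t` may vanish for
  -- `h ≠ 0`.
  set Q : ℝ → E := fun k => if k = 0 then v else k⁻¹ • (c (σ t + k) - c (σ t)) with hQ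
  have hQc : Tendsto Q (𝓝 0) (𝓝 v) := by
    have h0 : Tendsto Q (𝓝[≠] 0) (𝓝 v) := by
      refine Tendsto.congr' ?_ hc
      filter_upwards [self_mem_nhdsWithin] with k hk
      rw [hQ]
      simp only [if_neg (show k ≠ 0 from hk)]
    have h1 : Tendsto Q (pure 0) (𝓝 v) := by
      rw [tendsto_pure_left]
      intro s hs
      simpa [hQ] using mem_of_mem_nhds hs
    rw [← nhdsNE_sup_pure]
    exact h0.sup h1
  have hQe : ∀ k, c (σ t + k) - c (σ t) = k • Q k := by
    intro k
    by_cases hk : k = 0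
    · simp [hk]
    · simp [hQ, if_neg hk, smul_smul, mul_inv_cancel₀ hk]
  have hσ0 : Tendsto (fun h => σ (t + h) - σ t) (𝓝[≠] 0) (𝓝 0) := by
    have : Tendsto (fun h => σ (t + h) - σ t) (𝓝 0) (𝓝 (σ (t + 0) - σ t)) := by
      refine Tendsto.sub ?_ tendsto_const_nhds
      have h2 : Tendsto σ (𝓝 (t + 0)) (𝓝 (σ (t + 0))) := by
        rw [add_zero]; exact hσ.continuousAt
      exact h2.comp (tendsto_const_nhds.add tendsto_id)
    rw [add_zero, sub_self] at this
    exact this.mono_left nhdsWithin_le_nhds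
  have ha0 : Tendsto (fun h => a (t + h)) (𝓝[≠] 0) (𝓝 (a t)) := by
    have h2 : Tendsto a (𝓝 (t + 0)) (𝓝 (a (t + 0))) := by
      rw [add_zero]; exact ha.continuousAt
    have := h2.comp ((tendsto_const_nhds (x := t)).add (tendsto_id (x := 𝓝 (0 : ℝ))))
    rw [add_zero] at this
    exact this.mono_left nhdsWithin_le_nhds
  have h1 := hasDerivAt_iff_tendsto_slope_zero.1 ha
  have h2 := hasDerivAt_iff_tendsto_slope_zero.1 hσ
  refine ((h1.smul_const (c (σ t))).add ((ha0.mul h2).smul (hQc.comp hσ0))).congr fun h => ?_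
  have h3 := hQe (σ (t + h) - σ t)
  rw [add_sub_cancel] at h3
  simp only [Function.comp_apply, smul_eq_mul]
  have h4 : (a (t + h) * (h⁻¹ * (σ (t + h) - σ t))) • Q (σ (t + h) - σ t)
      = (h⁻¹ * a (t + h)) • (c (σ (t + h)) - c (σ t)) := by
    rw [h3, smul_smul]
    congr 1
    ring
  rw [h4]
  module

theorem IsSmoothCurve.exists_velocity {c : ℝ → E} (hc : IsSmoothCurve c) :
    ∃ c' : ℝ → E, IsSmoothCurve c' ∧ ∀ t, HasVelocity c (c' t) t := by
  obtain ⟨D, rfl, hD⟩ := hc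
  exact ⟨D 1, ⟨fun n => D (n + 1), rfl, fun n => hD (n + 1)⟩, hD 0⟩

theorem isSmoothCurve_of_closed (S : Set (ℝ → E))
    (hS : ∀ c ∈ S, ∃ c' ∈ S, ∀ t, HasVelocity c (c' t) t) {c : ℝ → E} (hc : c ∈ S) :
    IsSmoothCurve c := by
  choose! d hd hv using hS
  have hm : ∀ n, d^[n] c ∈ S := fun n => by
    induction n with
    | zero => exact hc
    | succ n ih => rw [Function.iterate_succ_apply']; exact hd _ ih
  exact ⟨fun n => d^[n] c, rfl, fun n t => by
    simp only [Function.iterate_succ_apply']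
    exact hv _ (hm n) t⟩

/-- Passing to the additive closure accommodates the sums that the Leibniz rule produces. -/
theorem isSmoothCurve_of_closure [ContinuousAdd E] (S : Set (ℝ → E))
    (hS : ∀ c ∈ S, ∃ c' ∈ AddSubmonoid.closure S, ∀ t, HasVelocity c (c' t) t) {c : ℝ → E}
    (hc : c ∈ AddSubmonoid.closure S) : IsSmoothCurve c := by
  refine isSmoothCurve_of_closed (AddSubmonoid.closure S : Set (ℝ → E)) (fun c hc => ?_) hc
  induction hc using AddSubmonoid.closure_induction with
  | mem c hc => exact hS c hc
  | zero => exact ⟨0, zero_mem _, fun t => by simpa [HasVelocity] using tendsto_const_nhds⟩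
  | add c d _ _ hc hd =>
    obtain ⟨c', hc', hcv⟩ := hc
    obtain ⟨d', hd', hdv⟩ := hd
    exact ⟨c' + d', add_mem hc' hd', fun t => (hcv t).add (hdv t)⟩

theorem isSmoothCurve_real_iff {u : ℝ → ℝ} : IsSmoothCurve u ↔ ContDiff ℝ ∞ u := by
  refine ⟨fun hu => ?_, fun hu => ?_⟩
  · rw [contDiff_infty]
    intro m
    induction m generalizing u with
    | zero =>
      obtain ⟨u', -, hv⟩ := hu.exists_velocity
      exact contDiff_zero.2 (continuous_iff_continuousAt.2 fun t =>
        (hasVelocity_real_iff.1 (hv t)).continuousAt)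
    | succ m ih =>
      obtain ⟨u', hu', hv⟩ := hu.exists_velocity
      rw [Nat.cast_succ, contDiff_succ_iff_deriv]
      refine ⟨fun t => (hasVelocity_real_iff.1 (hv t)).differentiableAt, by simp, ?_⟩
      rw [show deriv u = u' from funext fun t => (hasVelocity_real_iff.1 (hv t)).deriv]
      exact ih hu'
  · refine isSmoothCurve_of_closed {u | ContDiff ℝ ∞ u} (fun u hu => ?_) hu
    obtain ⟨h1, h2⟩ := contDiff_infty_iff_deriv.1 hu
    exact ⟨deriv u, h2, fun t => hasVelocity_real_iff.2 (h1 t).hasDerivAt⟩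

theorem IsSmoothCurve.clm (L : E →L[ℝ] F) {c : ℝ → E} (hc : IsSmoothCurve c) :
    IsSmoothCurve fun t => L (c t) := by
  refine isSmoothCurve_of_closed {d | ∃ c : ℝ → E, IsSmoothCurve c ∧ d = fun t => L (c t)} ?_
    ⟨c, hc, rfl⟩
  rintro _ ⟨c, hc, rfl⟩
  obtain ⟨c', hc', hv⟩ := hc.exists_velocity
  exact ⟨_, ⟨c', hc', rfl⟩, fun t => (hv t).clm L⟩

theorem IsSmoothCurve.add [ContinuousAdd E] {c d : ℝ → E} (hc : IsSmoothCurve c)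
    (hd : IsSmoothCurve d) : IsSmoothCurve fun t => c t + d t := by
  refine isSmoothCurve_of_closure {c : ℝ → E | IsSmoothCurve c} (fun c hc => ?_)
    (add_mem (AddSubmonoid.subset_closure hc) (AddSubmonoid.subset_closure hd))
  obtain ⟨c', hc', hv⟩ := hc.exists_velocity
  exact ⟨c', AddSubmonoid.subset_closure hc', hv⟩

theorem IsSmoothCurve.smul_comp [IsTopologicalAddGroup E] [ContinuousSMul ℝ E] {c : ℝ → E}
    (hc : IsSmoothCurve c) {a σ : ℝ → ℝ} (ha : ContDiff ℝ ∞ a) (hσ : ContDiff ℝ ∞ σ) :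
    IsSmoothCurve fun t => a t • c (σ t) := by
  refine isSmoothCurve_of_closure {d | ∃ (a : ℝ → ℝ) (c : ℝ → E), ContDiff ℝ ∞ a ∧
    IsSmoothCurve c ∧ d = fun t => a t • c (σ t)} ?_ (AddSubmonoid.subset_closure
      ⟨a, c, ha, hc, rfl⟩)
  rintro _ ⟨a, c, ha, hc, rfl⟩
  obtain ⟨c', hc', hv⟩ := hc.exists_velocity
  obtain ⟨h1, h2⟩ := contDiff_infty_iff_deriv.1 ha
  obtain ⟨h3, h4⟩ := contDiff_infty_iff_deriv.1 hσ
  exact ⟨(fun t => deriv a t • c (σ t)) + fun t => (a t * deriv σ t) • c' (σ t),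
    add_mem (AddSubmonoid.subset_closure ⟨_, c, h2, hc, rfl⟩)
      (AddSubmonoid.subset_closure ⟨_, c', ha.mul h4, hc', rfl⟩),
    fun t => HasVelocity.smul_comp (h1 t).hasDerivAt (h3 t).hasDerivAt (hv (σ t))⟩

theorem isSmoothCurve_const (v : E) : IsSmoothCurve fun _ => v := by
  refine ⟨fun n _ => if n = 0 then v else 0, by simp, fun n t => ?_⟩
  simpa using tendsto_const_nhds

theorem pow_smul_tendsto_zero {R : ℝ → E}
    (hR : Bornology.IsVonNBounded ℝ (R '' Icc (-1) 1)) {k : ℕ} (hk : k ≠ 0) :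
    Tendsto (fun h : ℝ => h ^ k • R h) (𝓝[≠] 0) (𝓝 0) := by
  refine hR.smul_tendsto_zero (ε := fun h : ℝ => h ^ k) ?_ ?_
  · filter_upwards [mem_nhdsWithin_of_mem_nhds (Icc_mem_nhds (neg_one_lt_zero (R := ℝ))
      one_pos)] with h hh
    exact mem_image_of_mem R hh
  · have : Tendsto (fun h : ℝ => h ^ k) (𝓝 0) (𝓝 (0 ^ k)) := (continuous_pow k).tendsto 0
    rw [zero_pow hk] at this
    exact this.mono_left nhdsWithin_le_nhds

end Curves

/-! ### Bounded linear and bilinear maps along smooth curves -/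

section Bounded

variable {E : Type*} [AddCommGroup E] [Module ℝ E] [TopologicalSpace E]
  [IsTopologicalAddGroup E] [ContinuousSMul ℝ E] [LocallyConvexSpace ℝ E]
  {F : Type*} [AddCommGroup F] [Module ℝ F] [TopologicalSpace F]
  [IsTopologicalAddGroup F] [ContinuousSMul ℝ F] [LocallyConvexSpace ℝ F]
  {G : Type*} [AddCommGroup G] [Module ℝ G] [TopologicalSpace G]
  [IsTopologicalAddGroup G]

/-- The scalar Taylor estimate bounds the normalized remainder weakly, and Mackey's theorem makes it
bounded. Bounded maps preserve exactly this information. -/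
theorem IsSmoothCurve.taylor {c c' : ℝ → E} (hc : IsSmoothCurve c)
    (hv : ∀ t, HasVelocity c (c' t) t) (t : ℝ) :
    ∃ R : ℝ → E, Bornology.IsVonNBounded ℝ (R '' Icc (-1) 1) ∧
      ∀ h, c (t + h) = c t + h • c' t + h ^ 2 • R h := by
  refine ⟨fun h => (h ^ 2)⁻¹ • (c (t + h) - c t - h • c' t),
    isVonNBounded_of_dual_bounded fun l => ?_, fun h => ?_⟩
  · have hu : ContDiff ℝ ∞ fun r => l (c r) := isSmoothCurve_real_iff.1 (hc.clm l)
    have hcont : Continuous (deriv (deriv fun r => l (c r))) :=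
      (contDiff_infty_iff_deriv.1 (contDiff_infty_iff_deriv.1 hu).2).2.continuous
    obtain ⟨C, hC⟩ := (isCompact_closedBall t 1).exists_bound_of_continuousOn hcont.continuousOn
    refine ⟨C, ?_⟩
    rintro _ ⟨h, hh, rfl⟩
    have hC0 : 0 ≤ C := (norm_nonneg _).trans (hC t (by simp))
    have h1 := abs_taylor_le hu (abs_le.2 hh) fun s hs => hC s (by
      rwa [Metric.mem_closedBall, Real.dist_eq])
    rw [(hasVelocity_real_iff.1 ((hv t).clm l)).deriv] at h1
    simp only [map_smul, map_sub, smul_eq_mul]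
    rw [abs_mul, abs_inv, abs_of_nonneg (sq_nonneg h)]
    exact inv_mul_le_of_le_mul₀ (sq_nonneg h) hC0 (h1.trans_eq (mul_comm _ _))
  · by_cases hh : h = 0
    · simp [hh]
    · rw [smul_smul, mul_inv_cancel₀ (pow_ne_zero 2 hh), one_smul]
      abel

theorem HasVelocity.bounded_linear (L : E →ₗ[ℝ] G)
    (hL : ∀ B : Set E, Bornology.IsVonNBounded ℝ B → Bornology.IsVonNBounded ℝ (L '' B))
    {c c' : ℝ → E} (hc : IsSmoothCurve c) (hv : ∀ t, HasVelocity c (c' t) t) (t : ℝ) :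
    HasVelocity (fun r => L (c r)) (L (c' t)) t := by
  obtain ⟨R, hR, he⟩ := hc.taylor hv t
  have h1 : Bornology.IsVonNBounded ℝ ((fun h => L (R h)) '' Icc (-1) 1) := by
    have := hL _ hR
    rwa [image_image] at this
  have h2 := (pow_smul_tendsto_zero h1 one_ne_zero).const_add (L (c' t))
  rw [add_zero] at h2
  refine h2.congr' ?_
  filter_upwards [self_mem_nhdsWithin] with h hh
  have hh : h ≠ 0 := hh
  rw [he, map_add, map_add, map_smul, map_smul, add_assoc, add_sub_cancel_left, smul_add,
    smul_smul, smul_smul, inv_mul_cancel₀ hh, one_smul]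
  congr 2
  field_simp

theorem HasVelocity.bounded_bilinear (B : E →ₗ[ℝ] F →ₗ[ℝ] G)
    (hB : ∀ (S : Set E) (T : Set F), Bornology.IsVonNBounded ℝ S → Bornology.IsVonNBounded ℝ T →
      Bornology.IsVonNBounded ℝ (image2 (fun x y => B x y) S T))
    {c c' : ℝ → E} {d d' : ℝ → F} (hc : IsSmoothCurve c) (hd : IsSmoothCurve d)
    (hcv : ∀ t, HasVelocity c (c' t) t) (hdv : ∀ t, HasVelocity d (d' t) t) (t : ℝ) :
    HasVelocity (fun r => B (c r) (d r)) (B (c' t) (d t) + B (c t) (d' t)) t := by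
  obtain ⟨R, hR, hRe⟩ := hc.taylor hcv t
  obtain ⟨Q, hQ, hQe⟩ := hd.taylor hdv t
  have key : ∀ (f : ℝ → E) (g : ℝ → F), Bornology.IsVonNBounded ℝ (f '' Icc (-1) 1) →
      Bornology.IsVonNBounded ℝ (g '' Icc (-1) 1) →
      ∀ {k : ℕ}, k ≠ 0 → Tendsto (fun h : ℝ => h ^ k • B (f h) (g h)) (𝓝[≠] 0) (𝓝 0) := by
    intro f g hf hg k hk
    refine pow_smul_tendsto_zero (R := fun h => B (f h) (g h))
      ((hB _ _ hf hg).subset ?_) hk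
    rintro _ ⟨h, hh, rfl⟩
    exact mem_image2_of_mem (mem_image_of_mem f hh) (mem_image_of_mem g hh)
  have hE : ∀ v : E, Bornology.IsVonNBounded ℝ ((fun _ : ℝ => v) '' Icc (-1) 1) := fun v =>
    (Bornology.isVonNBounded_singleton v).subset (by rintro _ ⟨_, -, rfl⟩; rfl)
  have hF : ∀ v : F, Bornology.IsVonNBounded ℝ ((fun _ : ℝ => v) '' Icc (-1) 1) := fun v =>
    (Bornology.isVonNBounded_singleton v).subset (by rintro _ ⟨_, -, rfl⟩; rfl)
  -- In the product of the two Taylor expansions, these six terms keep a positive power of `h` after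
  -- division by `h`.
  have h := ((((((key _ _ hR (hF (d t)) one_ne_zero).add
    (key _ _ hR (hF (d' t)) two_ne_zero)).add (key _ _ hR hQ three_ne_zero)).add
    (key _ _ (hE (c' t)) (hF (d' t)) one_ne_zero)).add
    (key _ _ (hE (c' t)) hQ two_ne_zero)).add
    (key _ _ (hE (c t)) hQ one_ne_zero)).const_add (B (c' t) (d t) + B (c t) (d' t))
  simp only [add_zero] at h
  refine h.congr' ?_
  filter_upwards [self_mem_nhdsWithin] with r hr
  have hr : r ≠ 0 := hr
  rw [hRe, hQe]
  simp only [map_add, map_smul, LinearMap.add_apply, LinearMap.smul_apply]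
  match_scalars <;> (field_simp; try ring)

theorem IsSmoothCurve.bounded_bilinear (B : E →ₗ[ℝ] F →ₗ[ℝ] G)
    (hB : ∀ (S : Set E) (T : Set F), Bornology.IsVonNBounded ℝ S → Bornology.IsVonNBounded ℝ T →
      Bornology.IsVonNBounded ℝ (image2 (fun x y => B x y) S T))
    {c : ℝ → E} {d : ℝ → F} (hc : IsSmoothCurve c) (hd : IsSmoothCurve d) :
    IsSmoothCurve fun t => B (c t) (d t) := by
  refine isSmoothCurve_of_closure {e | ∃ (c : ℝ → E) (d : ℝ → F), IsSmoothCurve c ∧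
    IsSmoothCurve d ∧ e = fun t => B (c t) (d t)} ?_ (AddSubmonoid.subset_closure
      ⟨c, d, hc, hd, rfl⟩)
  rintro _ ⟨c, d, hc, hd, rfl⟩
  obtain ⟨c', hc', hcv⟩ := hc.exists_velocity
  obtain ⟨d', hd', hdv⟩ := hd.exists_velocity
  exact ⟨(fun t => B (c' t) (d t)) + fun t => B (c t) (d' t),
    add_mem (AddSubmonoid.subset_closure ⟨c', d, hc', hd, rfl⟩)
      (AddSubmonoid.subset_closure ⟨c, d', hc, hd', rfl⟩),
    fun t => HasVelocity.bounded_bilinear B hB hc hd hcv hdv t⟩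

end Bounded

/-! ### Weakly smooth curves in convenient vector spaces -/

section Weak

/-- The slope with step `h` is the mean of `u'(t + θ h)` over `θ ∈ [0, 1]`, and `u'` is Lipschitz
near `t`; the mean value theorem in `θ` replaces the integral. -/
theorem abs_slope_sub_slope_le {u : ℝ → ℝ} (hu : ContDiff ℝ ∞ u) (t : ℝ) :
    ∃ C : ℝ, ∀ h k : ℝ, h ≠ 0 → k ≠ 0 → |h| ≤ 1 → |k| ≤ 1 →
      |h⁻¹ * (u (t + h) - u t) - k⁻¹ * (u (t + k) - u t)| ≤ C * |h - k| := by
  obtain ⟨hd, hu'⟩ := contDiff_infty_iff_deriv.1 hu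
  obtain ⟨hd', hu''⟩ := contDiff_infty_iff_deriv.1 hu'
  obtain ⟨C, hC⟩ := (isCompact_closedBall t 1).exists_bound_of_continuousOn
    hu''.continuous.continuousOn
  have hC0 : 0 ≤ C := (norm_nonneg _).trans (hC t (by simp))
  refine ⟨C, fun h k hh hk hh1 hk1 => ?_⟩
  have hmem : ∀ θ ∈ Icc (0 : ℝ) 1, ∀ r : ℝ, |r| ≤ 1 → t + θ * r ∈ Metric.closedBall t 1 := by
    intro θ hθ r hr
    rw [Metric.mem_closedBall, Real.dist_eq, add_sub_cancel_left, abs_mul, abs_of_nonneg hθ.1]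
    exact mul_le_one₀ hθ.2 (abs_nonneg r) hr
  have hder : ∀ r : ℝ, r ≠ 0 → ∀ θ : ℝ,
      HasDerivAt (fun θ => r⁻¹ * (u (t + θ * r) - u t)) (deriv u (t + θ * r)) θ := by
    intro r hr θ
    have h1 : HasDerivAt (fun θ : ℝ => t + θ * r) r θ := by
      simpa using ((hasDerivAt_id θ).mul_const r).const_add t
    have h2 := ((((hd (t + θ * r)).hasDerivAt.comp θ h1).sub_const (u t)).const_mul r⁻¹)
    exact h2.congr_deriv (by rw [mul_comm (deriv u _), inv_mul_cancel_left₀ hr])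
  have h1 := Convex.norm_image_sub_le_of_norm_deriv_le (s := Icc (0 : ℝ) 1) (x := 0) (y := 1)
    (f := (fun θ => h⁻¹ * (u (t + θ * h) - u t)) - fun θ => k⁻¹ * (u (t + θ * k) - u t)) (C := C * |h - k|)
    (fun θ _ => ((hder h hh θ).sub (hder k hk θ)).differentiableAt)
    (fun θ hθ => by
      have h2 := ((hder h hh θ).sub (hder k hk θ)).deriv
      have h3 := Convex.norm_image_sub_le_of_norm_deriv_le (f := deriv u) (C := C)
        (fun x _ => hd' x) hC (convex_closedBall t 1) (hmem θ hθ k hk1) (hmem θ hθ h hh1)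
      rw [h2]
      refine h3.trans (mul_le_mul_of_nonneg_left ?_ hC0)
      rw [add_sub_add_left_eq_sub, ← mul_sub, norm_mul, Real.norm_of_nonneg hθ.1]
      exact mul_le_of_le_one_left (norm_nonneg _) hθ.2)
    (convex_Icc 0 1) (by simp) (by simp)
  simpa using h1

variable {E : Type*} [AddCommGroup E] [Module ℝ E] [TopologicalSpace E] [ConvenientSpace E]

/-- The difference quotients `q h` are weakly Lipschitz in `h`, so by Mackey's theorem the set `S`
of their normalized differences is bounded. Hence `q (1 / (n + 1))` is Mackey-Cauchy, and the
Lipschitz bound carries its limit over to all `h → 0`. -/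
theorem exists_hasVelocity_of_weakly_smooth {c : ℝ → E}
    (hc : ∀ l : E →L[ℝ] ℝ, ContDiff ℝ ∞ fun r => l (c r)) (t : ℝ) : ∃ v, HasVelocity c v t := by
  set q : ℝ → E := fun h => h⁻¹ • (c (t + h) - c t) with hq
  set S : Set E := {x | ∃ h k : ℝ, h ≠ 0 ∧ k ≠ 0 ∧ |h| ≤ 1 ∧ |k| ≤ 1 ∧
    x = (h - k)⁻¹ • (q h - q k)} with hS
  have hqS : ∀ h k : ℝ, h ≠ 0 → k ≠ 0 → |h| ≤ 1 → |k| ≤ 1 →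
      ∃ b ∈ S, q h - q k = (h - k) • b := by
    intro h k hh hk hh1 hk1
    refine ⟨_, ⟨h, k, hh, hk, hh1, hk1, rfl⟩, ?_⟩
    by_cases hhk : h = k
    · simp [hhk]
    · rw [smul_smul, mul_inv_cancel₀ (sub_ne_zero.2 hhk), one_smul]
  have hSb : Bornology.IsVonNBounded ℝ S := by
    refine isVonNBounded_of_dual_bounded fun l => ?_
    obtain ⟨C, hC⟩ := abs_slope_sub_slope_le (hc l) t
    refine ⟨max C 0, ?_⟩
    rintro _ ⟨h, k, hh, hk, hh1, hk1, rfl⟩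
    have h1 := hC h k hh hk hh1 hk1
    simp only [hq, map_smul, map_sub, smul_eq_mul]
    rw [abs_mul, abs_inv]
    refine inv_mul_le_of_le_mul₀ (abs_nonneg _) (le_max_right _ _) (h1.trans ?_)
    rw [mul_comm]
    exact mul_le_mul_of_nonneg_left (le_max_left _ _) (abs_nonneg _)
  have hw := PolynormableSpace.withSeminorms ℝ E
  have hM := (hw.isVonNBounded_iff_seminorm_bounded).1 hSb
  choose M hM0 hM using hM
  -- An intersection of seminorm balls containing `S`: it is absolutely convex and still bounded.
  set B : Set E := {x | ∀ p : {p : Seminorm ℝ E // Continuous p}, p.1 x < M p} with hB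
  have hBabs : AbsConvex ℝ B := by
    refine ⟨?_, ?_⟩
    · intro a ha
      rintro _ ⟨x, hx, rfl⟩ p
      simp only [map_smul_eq_mul]
      exact (mul_le_of_le_one_left (apply_nonneg _ _) ha).trans_lt (hx p)
    · have : B = ⋂ p : {p : Seminorm ℝ E // Continuous p}, p.1.ball 0 (M p) := by
        ext x
        simp [hB]
      rw [this]
      exact convex_iInter fun p => p.1.convex_ball 0 (M p)
  have hBb : Bornology.IsVonNBounded ℝ B :=
    hw.isVonNBounded_iff_seminorm_bounded.2 fun p => ⟨M p, hM0 p, fun x hx => hx p⟩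
  set τ : ℕ → ℝ := fun n => 1 / ((n : ℝ) + 1) with hτ
  have hτ0 : ∀ n, τ n ≠ 0 := fun n => by positivity
  have hτ1 : ∀ n, |τ n| ≤ 1 := fun n => by
    rw [abs_of_nonneg (by positivity), hτ]
    simp only
    rw [div_le_one (by positivity)]
    linarith [(Nat.cast_nonneg n : (0 : ℝ) ≤ n)]
  have hτlim : Tendsto τ atTop (𝓝 0) := tendsto_one_div_add_atTop_nhds_zero_nat
  obtain ⟨a, ha⟩ := ConvenientSpace.mackey_complete (fun n => q (τ n))
    ⟨B, hBb, hBabs, fun mn => τ mn.1 - τ mn.2, by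
      rw [← prod_atTop_atTop_eq]
      simpa using (hτlim.comp tendsto_fst).sub (hτlim.comp tendsto_snd), fun m n => by
      obtain ⟨b, hb, he⟩ := hqS _ _ (hτ0 m) (hτ0 n) (hτ1 m) (hτ1 n)
      exact ⟨b, fun p => hM p b hb, he⟩⟩
  refine ⟨a, ?_⟩
  have hbound : ∀ p : {p : Seminorm ℝ E // Continuous p}, ∀ h : ℝ, h ≠ 0 → |h| ≤ 1 →
      p.1 (q h - a) ≤ |h| * M p := by
    intro p h hh hh1
    have h1 : Tendsto (fun n => p.1 (q h - q (τ n))) atTop (𝓝 (p.1 (q h - a))) :=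
      (p.2.tendsto _).comp (tendsto_const_nhds.sub ha)
    have h2 : Tendsto (fun n => |h - τ n| * M p) atTop (𝓝 (|h| * M p)) := by
      simpa using ((tendsto_const_nhds.sub hτlim).abs.mul_const (M p) :
        Tendsto (fun n => |h - τ n| * M p) atTop (𝓝 (|h - 0| * M p)))
    refine le_of_tendsto_of_tendsto' h1 h2 fun n => ?_
    obtain ⟨b, hb, he⟩ := hqS _ _ hh (hτ0 n) hh1 (hτ1 n)
    rw [he, map_smul_eq_mul, Real.norm_eq_abs]
    exact mul_le_mul_of_nonneg_left (hM p b hb).le (abs_nonneg _)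
  refine (hw.tendsto_nhds _ _).2 fun p ε hε => ?_
  have hlim : Tendsto (fun h : ℝ => |h| * M p) (𝓝[≠] 0) (𝓝 0) := by
    have : Tendsto (fun h : ℝ => |h| * M p) (𝓝 0) (𝓝 (|0| * M p)) :=
      (continuous_abs.mul continuous_const).tendsto 0
    rw [abs_zero, zero_mul] at this
    exact this.mono_left nhdsWithin_le_nhds
  filter_upwards [self_mem_nhdsWithin, hlim.eventually (gt_mem_nhds hε),
    mem_nhdsWithin_of_mem_nhds (Metric.closedBall_mem_nhds (0 : ℝ) one_pos)] with h hh h1 h2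
  exact (hbound p h hh (by simpa using h2)).trans_lt h1

theorem isSmoothCurve_of_weakly_smooth {c : ℝ → E}
    (hc : ∀ l : E →L[ℝ] ℝ, ContDiff ℝ ∞ fun r => l (c r)) : IsSmoothCurve c := by
  refine isSmoothCurve_of_closed {c : ℝ → E | ∀ l : E →L[ℝ] ℝ, ContDiff ℝ ∞ fun r => l (c r)}
    (fun c hc => ?_) hc
  choose c' hc' using exists_hasVelocity_of_weakly_smooth hc
  refine ⟨c', fun l => ?_, hc'⟩
  have : (fun r => l (c' r)) = deriv fun r => l (c r) :=
    funext fun t => (hasVelocity_real_iff.1 ((hc' t).clm l)).deriv.symm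
  rw [this]
  exact (contDiff_infty_iff_deriv.1 (hc l)).2

end Weak

/-! ### Derivatives of smooth mappings -/

section Derivatives

variable {F : Type*} [AddCommGroup F] [Module ℝ F] [TopologicalSpace F]
  [IsTopologicalAddGroup F] [ContinuousSMul ℝ F]

theorem IsSmoothMap.smoothAlong {f : F → ℝ} (hf : IsSmoothMap f) {X Y : ℝ → F}
    (hX : IsSmoothCurve X) (hY : IsSmoothCurve Y) :
    SmoothAlong fun p : ℝ × ℝ => f (X p.1 + p.2 • Y p.1) := by
  intro c hc
  have h1 := (hX.smul_comp (contDiff_const (c := (1 : ℝ))) hc.fst).add (hY.smul_comp hc.snd hc.fst)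
  simp only [one_smul] at h1
  exact isSmoothCurve_real_iff.1 (hf _ h1)

theorem isSmoothCurve_line (x v : F) : IsSmoothCurve fun s : ℝ => x + s • v :=
  (isSmoothCurve_const x).add ((isSmoothCurve_const v).smul_comp contDiff_id contDiff_id)

theorem IsSmoothMap.contDiff_differential {f : F → ℝ} (hf : IsSmoothMap f) {X Y : ℝ → F}
    (hX : IsSmoothCurve X) (hY : IsSmoothCurve Y) :
    ContDiff ℝ ∞ fun t => differential f (X t) (Y t) :=
  (hf.smoothAlong hX hY).contDiff_partial

theorem IsSmoothMap.differential {f : F → ℝ} (hf : IsSmoothMap f) (v : F) :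
    IsSmoothMap fun x => differential f x v := fun _ hc =>
  isSmoothCurve_real_iff.2 (hf.contDiff_differential hc (isSmoothCurve_const v))

theorem IsSmoothMap.differential_comm {f : F → ℝ} (hf : IsSmoothMap f) (x v w : F) :
    Convenient.differential (fun z => Convenient.differential f z v) x w
      = Convenient.differential (fun z => Convenient.differential f z w) x v := by
  have hsm : SmoothAlong fun p : ℝ × ℝ => f (x + p.1 • w + p.2 • v) :=
    hf.smoothAlong (isSmoothCurve_line x w) (isSmoothCurve_const v)
  have h := hsm.deriv_comm
  simp only [Convenient.differential]
  rw [h]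
  simp_rw [add_right_comm x _ (_ • v)]

theorem IsSmoothMap.iteratedDifferential {f : F → ℝ} (hf : IsSmoothMap f) (k : ℕ) (y : Fin k → F) :
    IsSmoothMap fun x => iteratedDifferential f k x y := by
  induction k with
  | zero => exact hf
  | succ k ih => exact (ih (Fin.tail y)).differential (y 0)

/-- By induction `z` moves to the second entry, and `differential_comm` exchanges the first two. -/
theorem IsSmoothMap.iteratedDifferential_insertNth {f : F → ℝ} (hf : IsSmoothMap f) {k : ℕ}
    (j : Fin (k + 1)) (x z : F) (y : Fin k → F) :
    Convenient.iteratedDifferential f (k + 1) x (j.insertNth (α := fun _ => F) z y)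
      = Convenient.iteratedDifferential f (k + 1) x (Fin.cons z y) := by
  induction k generalizing x z with
  | zero =>
    rw [Subsingleton.elim (α := Fin 1) j 0, Fin.insertNth_zero']
  | succ k ih =>
    induction j using Fin.cases with
    | zero => rw [Fin.insertNth_zero']
    | succ j =>
      have hy : y = Fin.cons (y 0) (Fin.tail y) := (Fin.cons_self_tail y).symm
      rw [hy, Fin.insertNth_succ_cons]
      change Convenient.differential (fun w => Convenient.iteratedDifferential f (k + 1) w
        (j.insertNth (α := fun _ => F) z (Fin.tail y))) x (y 0) = _
      simp_rw [ih]
      exact (hf.iteratedDifferential k (Fin.tail y)).differential_comm x z (y 0)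

/-- The recursion adds each new direction in front, so the innermost derivative sits in the last
entry. -/
theorem iteratedDifferential_differential {F : Type*} [AddCommGroup F] [Module ℝ F] (f : F → ℝ)
    (z : F) {k : ℕ} (x : F) (y : Fin k → F) :
    iteratedDifferential (fun w => differential f w z) k x y
      = iteratedDifferential f (k + 1) x (Fin.snoc (α := fun _ => F) y z) := by
  induction k generalizing x with
  | zero => rfl
  | succ k ih =>
    have hy : y = Fin.cons (y 0) (Fin.tail y) := (Fin.cons_self_tail y).symm
    rw [hy, ← Fin.cons_snoc_eq_snoc_cons]
    change differential (fun w => iteratedDifferential (fun w => differential f w z) k w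
        (Fin.tail y)) x (y 0)
      = differential (fun w => iteratedDifferential f (k + 1) w
        (Fin.snoc (α := fun _ => F) (Fin.tail y) z)) x (y 0)
    simp_rw [ih]

variable {E : Type*} [AddCommGroup E] [Module ℝ E] [TopologicalSpace E]

/-- The vector-valued differential of a mapping. -/
def vectorDifferential (g : F → E) (x v : F) : E :=
  Classical.epsilon fun w => HasVelocity (fun s : ℝ => g (x + s • v)) w 0

/-- The vector-valued iterated derivative of a mapping. -/
def iteratedVectorDifferential (g : F → E) : (k : ℕ) → F → (Fin k → F) → E
  | 0, x, _ => g x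
  | k + 1, x, y => vectorDifferential (fun z => iteratedVectorDifferential g k z (Fin.tail y)) x (y 0)

theorem IsSmoothMap.hasVelocity_line {g : F → E} (hg : IsSmoothMap g) (x v : F) :
    HasVelocity (fun s : ℝ => g (x + s • v)) (vectorDifferential g x v) 0 := by
  obtain ⟨c', -, hv⟩ := (hg _ (isSmoothCurve_line x v)).exists_velocity
  exact Classical.epsilon_spec (p := fun w => HasVelocity (fun s : ℝ => g (x + s • v)) w 0)
    ⟨c' 0, hv 0⟩

theorem IsSmoothMap.prod_left {F F' : Type*} [AddCommGroup F] [Module ℝ F] [TopologicalSpace F]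
    [IsTopologicalAddGroup F] [AddCommGroup F'] [Module ℝ F'] [TopologicalSpace F']
    [IsTopologicalAddGroup F'] {G : F × F' → E} (hG : IsSmoothMap G) (y : F') :
    IsSmoothMap fun x => G (x, y) := by
  intro d hd
  have h := hG _ ((hd.clm (ContinuousLinearMap.inl ℝ F F')).add
    (isSmoothCurve_const ((0 : F), y)))
  simpa using h

variable [ConvenientSpace E]

/-- Each continuous functional turns `ψ` into the differential of a scalar smooth map along `X` and
`Y`, so `ψ` is weakly smooth. -/
theorem IsSmoothMap.isSmoothCurve_of_hasVelocity {g : F → E} (hg : IsSmoothMap g) {X Y : ℝ → F}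
    (hX : IsSmoothCurve X) (hY : IsSmoothCurve Y) {ψ : ℝ → E}
    (hψ : ∀ t, HasVelocity (fun s : ℝ => g (X t + s • Y t)) (ψ t) 0) : IsSmoothCurve ψ := by
  refine isSmoothCurve_of_weakly_smooth fun l => ?_
  have hl : IsSmoothMap fun x => l (g x) := fun c hc => (hg c hc).clm l
  have : (fun t => l (ψ t)) = fun t => Convenient.differential (fun x => l (g x)) (X t) (Y t) :=
    funext fun t => (hasVelocity_real_iff.1 ((hψ t).clm l)).deriv.symm
  rw [this]
  exact hl.contDiff_differential hX hY

theorem IsSmoothMap.iteratedVectorDifferential {g : F → E} (hg : IsSmoothMap g) (k : ℕ) :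
    IsSmoothMap fun p : F × (Fin k → F) => iteratedVectorDifferential g k p.1 p.2 := by
  induction k with
  | zero => exact fun c hc => hg _ (hc.clm (ContinuousLinearMap.fst ℝ F (Fin 0 → F)))
  | succ k ih =>
    intro c hc
    let P : F × (Fin (k + 1) → F) →L[ℝ] F × (Fin k → F) :=
      (ContinuousLinearMap.fst ℝ _ _).prod (ContinuousLinearMap.pi fun i =>
        (ContinuousLinearMap.proj i.succ).comp (ContinuousLinearMap.snd ℝ _ _))
    let Q : F × (Fin (k + 1) → F) →L[ℝ] F × (Fin k → F) :=
      ((ContinuousLinearMap.proj 0).comp (ContinuousLinearMap.snd ℝ _ _)).prod 0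
    -- The derivative of order `k + 1` is that of order `k` differentiated at `P = (x, tail y)` in
    -- the direction `Q = (y 0, 0)`, which moves only the base point.
    refine ih.isSmoothCurve_of_hasVelocity (hc.clm P) (hc.clm Q) fun t => ?_
    have hPQ : ∀ s : ℝ, P (c t) + s • Q (c t)
        = ((c t).1 + s • (c t).2 0, Fin.tail (c t).2) := fun s => by
      refine Prod.ext rfl (funext fun i => ?_)
      simp [P, Q, Fin.tail]
    simp_rw [hPQ]
    exact (ih.prod_left (Fin.tail (c t).2)).hasVelocity_line (c t).1 ((c t).2 0)

theorem BoundedDual.apply_iteratedVectorDifferential {g : F → E} (hg : IsSmoothMap g)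
    (z : BoundedDual E) (k : ℕ) (x : F) (y : Fin k → F) :
    z (iteratedVectorDifferential g k x y) = iteratedDifferential (fun w => z (g w)) k x y := by
  induction k generalizing x with
  | zero => rfl
  | succ k ih =>
    have hG := (hg.iteratedVectorDifferential k).prod_left (Fin.tail y)
    have hv := hG.hasVelocity_line x (y 0)
    obtain ⟨c', -, hc'⟩ := (hG _ (isSmoothCurve_line x (y 0))).exists_velocity
    have h1 := HasVelocity.bounded_linear z.toLin (fun _ hB => z.bounded hB)
      (hG _ (isSmoothCurve_line x (y 0))) hc' 0
    rw [(hc' 0).unique hv] at h1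
    have h2 := (hasVelocity_real_iff.1 h1).deriv
    have h3 : ∀ s : ℝ, z.toLin (iteratedVectorDifferential g k (x + s • y 0) (Fin.tail y))
      = iteratedDifferential (fun w => z (g w)) k (x + s • y 0) (Fin.tail y) := fun s => ih _ _
    simp_rw [h3] at h2
    exact h2.symm

end Derivatives

/-! ### The topology of the dual -/

namespace BoundedDual

section Topology

variable {E : Type*} [AddCommGroup E] [Module ℝ E] [TopologicalSpace E]

instance : IsTopologicalAddGroup (BoundedDual E) :=
  topologicalAddGroup_induced
    ({ toFun := fun l => UniformOnFun.ofFun {B : Set E | Bornology.IsVonNBounded ℝ B} (toFunLin l)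
       map_zero' := rfl
       map_add' := fun _ _ => rfl } :
      BoundedDual E →+ UniformOnFun E ℝ {B : Set E | Bornology.IsVonNBounded ℝ B})

theorem hasBasis_nhds_zero [ContinuousSMul ℝ E] : (𝓝 (0 : BoundedDual E)).HasBasis
    (fun Bε : Set E × ℝ => Bornology.IsVonNBounded ℝ Bε.1 ∧ 0 < Bε.2)
    fun Bε => {l | ∀ x ∈ Bε.1, |l x| < Bε.2} := by
  have h := UniformOnFun.hasBasis_nhds_zero_of_basis (G := ℝ)
    {B : Set E | Bornology.IsVonNBounded ℝ B}
    ⟨∅, Bornology.isVonNBounded_empty ℝ E⟩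
    (directedOn_of_sup_mem fun _ _ => Bornology.IsVonNBounded.union)
    (Metric.nhds_basis_ball (x := (0 : ℝ)))
  have h2 := h.comap (UniformOnFun.ofFun {B : Set E | Bornology.IsVonNBounded ℝ B} ∘
    (toFunLin : BoundedDual E → E → ℝ))
  have h3 : 𝓝 (0 : BoundedDual E) = comap (UniformOnFun.ofFun
      {B : Set E | Bornology.IsVonNBounded ℝ B} ∘ (toFunLin : BoundedDual E → E → ℝ)) (𝓝 0) :=
    nhds_induced _ _
  rw [h3]
  refine h2.to_hasBasis (fun Bε hB => ⟨Bε, hB, ?_⟩) (fun Bε hB => ⟨Bε, hB, ?_⟩)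
  · intro l hl x hx
    exact mem_ball_zero_iff.2 (hl x hx)
  · intro l hl x hx
    exact mem_ball_zero_iff.1 (hl x hx)

instance [ContinuousSMul ℝ E] : LocallyConvexSpace ℝ (BoundedDual E) := by
  refine LocallyConvexSpace.ofBasisZero ℝ (BoundedDual E) _ _ hasBasis_nhds_zero fun Bε _ => ?_
  intro l hl m hm a b ha hb hab x hx
  have h1 : (a • l + b • m : BoundedDual E) x = a * l x + b * m x := rfl
  have h2 := convex_ball (0 : ℝ) Bε.2 (mem_ball_zero_iff.2 (hl x hx))
    (mem_ball_zero_iff.2 (hm x hx)) ha hb hab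
  rw [h1]
  exact mem_ball_zero_iff.1 h2

/-- Reduces boundedness of the coadjoint map to boundedness of the bracket. -/
theorem isVonNBounded_iff [ContinuousSMul ℝ E] {A : Set (BoundedDual E)} :
    Bornology.IsVonNBounded ℝ A ↔ ∀ B : Set E, Bornology.IsVonNBounded ℝ B →
      Bornology.IsVonNBounded ℝ (image2 (fun (l : BoundedDual E) x => l x) A B) := by
  rw [hasBasis_nhds_zero.isVonNBounded_iff]
  constructor
  · intro h B hB
    rw [NormedSpace.isVonNBounded_iff, isBounded_iff_forall_norm_le]
    obtain ⟨r, hr, hA⟩ := (h (B, 1) ⟨hB, one_pos⟩).exists_pos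
    refine ⟨r, ?_⟩
    rintro _ ⟨l, hl, x, hx, rfl⟩
    obtain ⟨m, hm, rfl⟩ := hA r (le_abs_self r) hl
    have h1 : (r • m : BoundedDual E) x = r * m x := rfl
    have h2 := hm x hx
    change ‖(r • m : BoundedDual E) x‖ ≤ r
    rw [h1, norm_mul, Real.norm_of_nonneg hr.le]
    exact mul_le_of_le_one_right hr.le h2.le
  · rintro h ⟨B, ε⟩ ⟨hB, hε⟩
    have h1 := h B hB
    rw [NormedSpace.isVonNBounded_iff, isBounded_iff_forall_norm_le] at h1
    obtain ⟨M, hM⟩ := h1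
    refine Absorbs.of_norm ⟨(|M| + 1) / ε, fun a ha l hl => ?_⟩
    have ha0 : 0 < ‖a‖ := lt_of_lt_of_le (by positivity) ha
    refine ⟨a⁻¹ • l, fun x hx => ?_, smul_inv_smul₀ (norm_pos_iff.1 ha0) l⟩
    have h2 := hM _ (mem_image2_of_mem hl hx)
    have h3 : (a⁻¹ • l : BoundedDual E) x = a⁻¹ * l x := rfl
    rw [h3, abs_mul, abs_inv, ← Real.norm_eq_abs a, inv_mul_lt_iff₀ ha0]
    rw [div_le_iff₀ hε] at ha
    rw [Real.norm_eq_abs] at h2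
    linarith [le_abs_self M]

end Topology

section Coadjoint

variable {𝔤 : Type*} [LieRing 𝔤] [LieAlgebra ℝ 𝔤] [TopologicalSpace 𝔤] [ConvenientLieAlgebra 𝔤]

/-- The bilinear map `(x, X) ↦ P_x(X, ·)`. -/
def coadjoint : BoundedDual 𝔤 →ₗ[ℝ] 𝔤 →ₗ[ℝ] BoundedDual 𝔤 :=
  LinearMap.mk₂ ℝ
    (fun x X => ⟨(liePoisson x).toBilin X, fun B hB => by
      have h := (liePoisson x).bounded {X} B (Bornology.isVonNBounded_singleton X) hB
      rwa [image2_singleton_left] at h⟩)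
    (fun _ _ _ => rfl) (fun _ _ _ => rfl)
    (fun x X X' => ext fun Y => LinearMap.congr_fun (map_add (liePoisson x).toBilin X X') Y)
    (fun r x X => ext fun Y => LinearMap.congr_fun (map_smul (liePoisson x).toBilin r X) Y)

theorem coadjoint_bounded (S : Set (BoundedDual 𝔤)) (T : Set 𝔤) (hS : Bornology.IsVonNBounded ℝ S)
    (hT : Bornology.IsVonNBounded ℝ T) :
    Bornology.IsVonNBounded ℝ (image2 (fun x X => coadjoint x X) S T) := by
  rw [isVonNBounded_iff]
  intro B hB
  refine (isVonNBounded_iff.1 hS _ (ConvenientLieAlgebra.bounded_bracket T B hT hB)).subset ?_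
  rintro _ ⟨_, ⟨x, hx, X, hX, rfl⟩, Y, hY, rfl⟩
  exact ⟨x, hx, ⁅X, Y⁆, ⟨X, hX, Y, hY, rfl⟩, rfl⟩

end Coadjoint

end BoundedDual

/-! ### The three conditions -/

section Conditions

variable {𝔤 : Type*} [LieRing 𝔤] [LieAlgebra ℝ 𝔤] [TopologicalSpace 𝔤] [ConvenientLieAlgebra 𝔤]
  {f : BoundedDual 𝔤 → ℝ}

theorem toBidual_apply (v : 𝔤) (z : BoundedDual 𝔤) : toBidual v z = z v := rfl

theorem DifferentialFactorsSmoothly.derivativeEntryLiesIn (hf : IsSmoothMap f)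
    (h : DifferentialFactorsSmoothly f) (k : ℕ) (j : Fin (k + 1)) :
    DerivativeEntryLiesIn f k j := by
  obtain ⟨g, hg, hgf⟩ := h
  refine ⟨fun p => iteratedVectorDifferential g k p.1 p.2, hg.iteratedVectorDifferential k,
    fun x y z => ?_⟩
  have h1 : (fun w => z (g w)) = fun w => differential f w z := funext fun w => hgf w z
  -- The vector `d^k g` yields `z` in the last entry; both this and the `j`-th entry are brought to
  -- the first one by symmetry.
  rw [toBidual_apply, BoundedDual.apply_iteratedVectorDifferential hg, h1,
    iteratedDifferential_differential, ← Fin.insertNth_last',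
    hf.iteratedDifferential_insertNth, hf.iteratedDifferential_insertNth]

theorem DerivativeEntryLiesIn.differentialFactorsSmoothly (h : DerivativeEntryLiesIn f 0 0) :
    DifferentialFactorsSmoothly f := by
  obtain ⟨G, hG, hGf⟩ := h
  exact ⟨fun x => G (x, 0), hG.prod_left 0, fun x y => hGf x 0 y⟩

theorem DifferentialFactorsSmoothly.exists_isPGradient (h : DifferentialFactorsSmoothly f) :
    ∃ X : BoundedDual 𝔤 → BoundedDual 𝔤, IsSmoothMap X ∧ IsPGradient f X := by
  obtain ⟨g, hg, hgf⟩ := h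
  exact ⟨fun x => BoundedDual.coadjoint x (g x),
    fun c hc => hc.bounded_bilinear BoundedDual.coadjoint BoundedDual.coadjoint_bounded (hg c hc),
    fun x => ⟨g x, hgf x, fun _ => rfl⟩⟩

end Conditions

end Convenient

end

theorem mainTheorem5 (𝔤 : Type*) [LieRing 𝔤] [LieAlgebra ℝ 𝔤] [TopologicalSpace 𝔤]
    [Convenient.ConvenientLieAlgebra 𝔤] (f : Convenient.BoundedDual 𝔤 → ℝ)
    (hf : Convenient.IsSmoothMap f) :
    (Convenient.DifferentialFactorsSmoothly f ↔
      ∀ k : ℕ, Convenient.DerivativeEntryLiesIn f k 0) ∧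
    ((∀ k : ℕ, Convenient.DerivativeEntryLiesIn f k 0) →
      ∀ (k : ℕ) (j : Fin (k + 1)), Convenient.DerivativeEntryLiesIn f k j) ∧
    (Convenient.DifferentialFactorsSmoothly f →
      ∃ X : Convenient.BoundedDual 𝔤 → Convenient.BoundedDual 𝔤,
        Convenient.IsSmoothMap X ∧ Convenient.IsPGradient f X) ∧
    ((∀ k : ℕ, Convenient.DerivativeEntryLiesIn f k 0) →
      ∃ X : Convenient.BoundedDual 𝔤 → Convenient.BoundedDual 𝔤,
        Convenient.IsSmoothMap X ∧ Convenient.IsPGradient f X) :=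
  ⟨⟨fun h k => h.derivativeEntryLiesIn hf k 0, fun h => (h 0).differentialFactorsSmoothly⟩,
    fun h => (h 0).differentialFactorsSmoothly.derivativeEntryLiesIn hf,
    fun h => h.exists_isPGradient,
    fun h => (h 0).differentialFactorsSmoothly.exists_isPGradient⟩
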